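/- Let $N=\{x\in\mathbb Z^6: x_1+\dots+x_6=0\}$, $M=\operatorname{Hom}(N,\mathbb Z)=\mathbb Z^6/\mathbb Z(1,\dots,1)$, and let $t_i\in M$ be the class of $e_i$, written multiplicatively, so that $t_1\cdots t_6=1$ on the torus $\mathbb T_N=\operatorname{Spec}\mathbb C[M]$. For $1\le i_1\le i_2\le i_3\le 6$ put $$u_{i_1i_2i_3}=e_{i_1}+e_{i_2}+e_{i_3}-e_1-e_2-e_3,\qquad v_{i_1i_2i_3}=e_{i_1}+e_{i_2}+e_{i_3}-e_4-e_5-e_6 .$$ *The fan.* Let $p_0,\dots,p_d$ be lattice points. A maximal simplex of the $3$-fold edgewise subdivision of the ordered simplex $\operatorname{conv}(p_0,\dots,p_d)$ is given by a $3\times(d+1)$ matrix $m$ which, read row by row, increases weakly through $0,\dots,d$, each increase being a step of $1$ inside a row and occurring, for every $c<d$, in exactly one row between the columns $c$ and $c+1$; its vertices are $\frac13(p_{m_{1c}}+p_{m_{2c}}+p_{m_{3c}})$, $0\le c\le d$. Let $\Pi$ be the smooth complete fan in $N_{\mathbb R}$ whose maximal cones are the cones over: the maximal simplices of the subdivision of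 $\operatorname{conv}(u_{kkk}:k\ne i)$ for $i\in\{1,2,3\}$; the maximal simplices of the subdivision of $\operatorname{conv}(v_{kkk}:k\neq j)$ for $j\in\{4,5,6\}$; and, for $i\in\{1,2,3\}$, $j\in\{4,5,6\}$, the simplices $\operatorname{conv}(q_0,\dots,q_s,q_s+w,\dots,q_3+w)$, $0\le s\le 3$, where $\operatorname{conv}(q_0,\dots,q_3)$ is a maximal simplex, with its vertices in column order, of the subdivision of $\operatorname{conv}(u_{kkk}:k\ne i,j)$ and $w=e_1+e_2+e_3-e_4-e_5-e_6$ (vertices $kkk$ are ordered by $k$). Its rays are the $u_{i_1i_2i_3}$ with $(i_1,i_2,i_3)\neq(1,2,3)$ and the $v_{i_1i_2i_3}$ with $(i_1,i_2,i_3)\ne(4,5,6)$. Let $\mathbb P_\Pi$ be the toric variety of $\Pi$ over $\mathbb C$; use the same symbols for the variables of its Cox ring, and let $D_1$, $D_2$ be the sums of all divisors $D_{u_{i_1i_2i_3}}$, respectively $D_{v_{i_1i_2i_3}}$. *The families.* For $b,b',a_1,\dots,a_6$ in a $\mathbb C$-algebra $R$ let $\mathscr Y(b,b';a)\subset \mathbb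 P_\Pi\times\operatorname{Spec}R$ be the scheme-theoretic intersection of the zero schemes of $$b\prod u_{i_1i_2i_3}-\sum_{k=1}^3a_k\,x^{(k)},\qquad b'\prod v_{i_1i_2i_3}-\sum_{k=4}^6a_k\,x^{(k)},\qquad x^{(k)}=\prod v_{i_1i_2i_3}^{\delta_{i_1}^k+\delta_{i_2}^k+\delta_{i_3}^k}\prod u_{i_1i_2i_3}^{\delta_{i_1}^k+\delta_{i_2}^k+\delta_{i_3}^k},$$ which are the sections of $\mathcal O(D_1)$ and $\mathcal O(D_2)$ given on the torus by $b-a_1t_1-a_2t_2-a_3t_3$ and $b'-a_4t_4-a_5t_5-a_6t_6$. Put * $\mathscr Y_{\xi_1,\xi_2,a_1,\dots,a_6}=\mathscr Y(3\xi_1,3\xi_2;a)$ (the Batyrev–Borisov family), * $\mathscr Y_\psi=\mathscr Y(3\psi,3\psi;1,\dots,1)$ over $\mathbb C-\{0\}=\operatorname{Spec}\mathbb C[\psi,\psi^{-1}]$, * $\mathscr Y_z=\mathscr Y(1,1;1,1,1,1,1,z)$ over $\mathbb C-\{0\}=\operatorname{Spec}\mathbb C[z,z^{-1}]$. Let $U_1=\{(\xi_1:a_1:a_2:a_3)\in\mathbb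 P^3:\xi_1a_1a_2a_3\neq0\}$ and $U_2=\{(\xi_2:a_4:a_5:a_6)\in\mathbb P^3:\xi_2a_4a_5a_6\ne0\}$; over $U_1\times U_2$ the Batyrev–Borisov family is written with coordinates normalized by $\xi_1=\xi_2=1$. **Proposition.** 1. As families of closed subschemes of $\mathbb T_N$ over $\mathbb C-\{0\}$, $$\mathscr Y_z\cap\mathbb T_N=V\Bigl(1-t_1-t_2-t_3,\;1-t_4-t_5-\frac{z}{t_1\cdots t_5}\Bigr).$$ 2. Let $S=U_1\times U_2$ and $\zeta:S\to\mathbb C-\{0\}$, $\zeta=\dfrac{a_1\cdots a_6}{(3\xi_1)^3(3\xi_2)^3}$. The automorphism of $\mathbb T_N\times S$ over $S$ given by the translation with $t_i\mapsto\frac{a_i}{3\xi_1}t_i$ for $i=1,2,3$ and $t_i\mapsto\frac{a_i}{3\xi_2}t_i$ for $i=4,5$ extends to an automorphism $\Phi$ of $\mathbb P_\Pi\times S$ over $S$ such that the closed subscheme $\mathscr Y_{\xi_1,\xi_2,a_1,\dots,a_6}$ is the preimage of $\mathscr Y_z$ under $(\mathrm{id}\times\zeta)\circ\Phi$. In particular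 $\mathscr Y_{\xi_1,\xi_2,a_1,\dots,a_6}\cong\mathscr Y_z\times_{\mathbb C-\{0\}}S$ over $S$. The same holds over $S=\operatorname{Spec}R$ for every $\mathbb C$-algebra $R$ and all units $\xi_1,\xi_2,a_1,\dots,a_6\in R^\times$, in particular for each single fiber. 3. The same holds for the family $\mathscr Y_\psi$ over $S=\mathbb C-\{0\}$, with $\zeta=(3\psi)^{-6}$ and the translation $t_i\mapsto\frac{1}{3\psi}t_i$ for $1\le i\le5$. -/

import Mathlib

open CategoryTheory CategoryTheory.Limits AlgebraicGeometry TensorProduct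

noncomputable section

/-! ### Toric varieties of fans -/

namespace Toric

section Fan

variable {N : Type} [AddCommGroup N] {ι : Type} (vec : ι → N)

/-- A cone is given by the set `σ` of its ray generators `vec ρ`, `ρ ∈ σ`. With
`M = Hom(N, ℤ)`, this is the monoid `σ^∨ ∩ M = {m ∈ M : ⟨m, ρ⟩ ≥ 0 for all ρ ∈ σ}`. -/
def dualMonoid (σ : Set ι) : AddSubmonoid (Module.Dual ℤ N) where
  carrier := {m | ∀ ρ ∈ σ, 0 ≤ m (vec ρ)}
  zero_mem' := fun _ _ => le_rfl
  add_mem' := fun ha hb ρ hρ => add_nonneg (ha ρ hρ) (hb ρ hρ)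

/-- The coordinate ring `R[σ^∨ ∩ M]` of the affine toric chart of `σ` over `R`. -/
abbrev ConeRing (R : Type) [CommRing R] (σ : Set ι) : Type :=
  AddMonoidAlgebra R (dualMonoid vec σ)

/-- `cone(τ)` is the face of `cone(σ)` cut out by a supporting hyperplane `m = 0`, `m ∈ M`,
and `τ` consists of the generators of `σ` that lie on it. -/
def IsFace (τ σ : Set ι) : Prop :=
  τ ⊆ σ ∧ ∃ m : Module.Dual ℤ N,
    (∀ ρ ∈ τ, m (vec ρ) = 0) ∧ ∀ ρ ∈ σ, ρ ∉ τ → 0 < m (vec ρ)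

theorem IsFace.dualMonoid_le {τ σ : Set ι} (h : IsFace vec τ σ) :
    dualMonoid vec σ ≤ dualMonoid vec τ :=
  fun _ hm ρ hρ => hm ρ (h.1 hρ)

theorem IsFace.refl (σ : Set ι) : IsFace vec σ σ :=
  ⟨subset_rfl, 0, by simp, fun _ h h' => absurd h h'⟩

theorem exists_nsmul_add_nonneg [Finite ι] {σ : Set ι} (p m : Module.Dual ℤ N)
    (hm : ∀ ρ ∈ σ, 0 ≤ m (vec ρ)) (hp : ∀ ρ ∈ σ, m (vec ρ) = 0 → 0 ≤ p (vec ρ)) :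
    ∃ n : ℕ, ∀ ρ ∈ σ, 0 ≤ p (vec ρ) + n * m (vec ρ) := by
  cases nonempty_fintype ι
  refine ⟨∑ ρ, (p (vec ρ)).natAbs, fun ρ hρ => ?_⟩
  have h1 : (p (vec ρ)).natAbs ≤ ∑ ρ, (p (vec ρ)).natAbs :=
    Finset.single_le_sum (f := fun ρ => (p (vec ρ)).natAbs) (fun _ _ => Nat.zero_le _)
      (Finset.mem_univ ρ)
  rcases (hm ρ hρ).eq_or_lt with h | h
  · simpa [← h] using hp ρ hρ h.symm
  · generalize (∑ ρ, (p (vec ρ)).natAbs) = s at *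
    have h2 : (0 : ℤ) ≤ p (vec ρ) + s := by omega
    nlinarith

theorem IsFace.trans [Finite ι] {τ σ υ : Set ι} (h : IsFace vec τ σ) (h' : IsFace vec σ υ) :
    IsFace vec τ υ := by
  obtain ⟨hs, m, hm0, hm⟩ := h
  obtain ⟨hs', m', hm0', hm'⟩ := h'
  have hm'nn : ∀ ρ ∈ υ, 0 ≤ m' (vec ρ) := fun ρ hρ => by
    by_cases hρ' : ρ ∈ σ
    · exact (hm0' ρ hρ').ge
    · exact (hm' ρ hρ hρ').le
  obtain ⟨n, hn⟩ := exists_nsmul_add_nonneg vec (σ := υ) m m' hm'nn fun ρ hρ h0 => by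
    have hρ' : ρ ∈ σ := by
      by_contra hc
      exact (hm' ρ hρ hc).ne' h0
    by_cases hc : ρ ∈ τ
    · exact (hm0 ρ hc).ge
    · exact (hm ρ hρ' hc).le
  refine ⟨hs.trans hs', m + (n + 1) • m', fun ρ hρ => ?_, fun ρ hρ hρτ => ?_⟩
  · simp [hm0 ρ hρ, hm0' ρ (hs hρ)]
  · have h1 := hn ρ hρ
    have h2 : (m + (n + 1) • m') (vec ρ) = m (vec ρ) + n * m' (vec ρ) + m' (vec ρ) := by
      simp only [LinearMap.add_apply, LinearMap.smul_apply, nsmul_eq_mul, Nat.cast_add,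
        Nat.cast_one]
      ring
    rw [h2]
    by_cases hσ : ρ ∈ σ
    · simpa [hm0' ρ hσ] using hm ρ hσ hρτ
    · have := hm' ρ hρ hσ
      omega

/-- The cones of the fan whose maximal cones are the members of `mx`: all their faces. -/
def FanCone (mx : Set (Set ι)) : Type := {τ : Set ι // ∃ σ ∈ mx, IsFace vec τ σ}

variable {vec} {mx : Set (Set ι)}

/-- The cones of a fan, partially ordered by the relation of being a face. -/
instance [Finite ι] : PartialOrder (FanCone vec mx) where
  le τ σ := IsFace vec τ.1 σ.1
  le_refl σ := IsFace.refl vec σ.1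
  le_trans _ _ _ h h' := IsFace.trans vec h h'
  le_antisymm _ _ h h' := Subtype.ext (h.1.antisymm h'.1)

variable (vec mx)

/-- For a face `τ` of `σ`, the inclusion `R[σ^∨ ∩ M] ⊆ R[τ^∨ ∩ M]`. -/
def faceMap (R : Type) [CommRing R] {τ σ : Set ι} (h : IsFace vec τ σ) :
    ConeRing vec R σ →+* ConeRing vec R τ :=
  AddMonoidAlgebra.mapDomainRingHom R (AddSubmonoid.inclusion (h.dualMonoid_le vec))

theorem faceMap_away (R : Type) [CommRing R] [Finite ι] {τ σ : Set ι} (h : IsFace vec τ σ)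
    (m : dualMonoid vec σ) (hm0 : ∀ ρ ∈ τ, m.1 (vec ρ) = 0)
    (hm : ∀ ρ ∈ σ, ρ ∉ τ → 0 < m.1 (vec ρ)) :
    @IsLocalization.Away _ _ (AddMonoidAlgebra.single m (1 : R)) (ConeRing vec R τ) _
      (faceMap vec R h).toAlgebra := by
  let _ := (faceMap vec R h).toAlgebra
  have hal : ∀ x, algebraMap (ConeRing vec R σ) (ConeRing vec R τ) x = faceMap vec R h x :=
    fun _ => rfl
  have hfs : ∀ (a : dualMonoid vec σ) (r : R), faceMap vec R h (AddMonoidAlgebra.single a r) =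
      AddMonoidAlgebra.single (AddSubmonoid.inclusion (h.dualMonoid_le vec) a) r := by
    intro a r
    simp [faceMap]
  let m' : dualMonoid vec τ := ⟨-m.1, fun ρ hρ => by simp [hm0 ρ hρ]⟩
  have hmm : AddSubmonoid.inclusion (h.dualMonoid_le vec) m + m' = 0 := by
    ext1
    simp [m']
  refine IsLocalization.Away.mk _ ?_ ?_ ?_
  · rw [hal, hfs]
    refine IsUnit.of_mul_eq_one (AddMonoidAlgebra.single m' 1) ?_
    rw [AddMonoidAlgebra.single_mul_single, hmm, one_mul, AddMonoidAlgebra.one_def]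
  · intro z
    induction z using AddMonoidAlgebra.induction_linear with
    | zero => exact ⟨0, 0, by simp⟩
    | add x y hx hy =>
      obtain ⟨n, a, ha⟩ := hx
      obtain ⟨k, b, hb⟩ := hy
      refine ⟨n + k, a * AddMonoidAlgebra.single m 1 ^ k + b * AddMonoidAlgebra.single m 1 ^ n, ?_⟩
      rw [map_add, map_mul, map_mul, ← ha, ← hb, map_pow, map_pow]
      ring
    | single p r =>
      have hmnn : ∀ ρ ∈ σ, 0 ≤ m.1 (vec ρ) := m.2
      obtain ⟨n, hn⟩ := exists_nsmul_add_nonneg vec (σ := σ) p.1 m.1 hmnn fun ρ hρ h0 => by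
        refine p.2 ρ ?_
        by_contra hc
        exact (hm ρ hρ hc).ne' h0
      refine ⟨n, AddMonoidAlgebra.single ⟨p.1 + n • m.1, fun ρ hρ => by simpa using hn ρ hρ⟩ r, ?_⟩
      rw [hal, hal, hfs, hfs, AddMonoidAlgebra.single_pow, AddMonoidAlgebra.single_mul_single]
      simp only [one_pow, mul_one]
      congr 1
  · intro a b hab
    refine ⟨0, ?_⟩
    have hinj : Function.Injective (faceMap vec R h) := by
      refine AddMonoidAlgebra.mapDomain_injective ?_
      exact AddSubmonoid.inclusion_injective _
    rw [hinj hab]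

/-- The diagram `σ ↦ Spec ℂ[σ^∨ ∩ M]` of affine toric varieties, indexed by the cones of a fan. -/
def charts [Finite ι] : FanCone vec mx ⥤ Scheme.{0} where
  obj σ := Spec (.of (ConeRing vec ℂ σ.1))
  map f := Spec.map (CommRingCat.ofHom (faceMap vec ℂ f.le))
  map_id σ := by
    rw [← Spec.map_id]
    congr 1
    ext x
    · simp [faceMap]
    · simp [faceMap]
      rfl
  map_comp f g := by
    rw [← Spec.map_comp]
    congr 1
    ext x
    · simp [faceMap]
    · simp [faceMap]
      rfl

theorem charts_map_range [Finite ι] {τ σ : FanCone vec mx} (f : τ ⟶ σ)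
    (m : dualMonoid vec σ.1) (hm0 : ∀ ρ ∈ τ.1, m.1 (vec ρ) = 0)
    (hm : ∀ ρ ∈ σ.1, ρ ∉ τ.1 → 0 < m.1 (vec ρ)) :
    IsOpenImmersion ((charts vec mx).map f) ∧ Set.range ((charts vec mx).map f) =
      (PrimeSpectrum.basicOpen (AddMonoidAlgebra.single m (1 : ℂ) : ConeRing vec ℂ σ.1) :
        Set (PrimeSpectrum (ConeRing vec ℂ σ.1))) := by
  let _ := (faceMap vec ℂ f.le).toAlgebra
  have := faceMap_away vec ℂ f.le m hm0 hm
  refine ⟨IsOpenImmersion.of_isLocalization (AddMonoidAlgebra.single m (1 : ℂ)), ?_⟩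
  exact PrimeSpectrum.localization_away_comap_range (ConeRing vec ℂ τ.1)
    (AddMonoidAlgebra.single m (1 : ℂ))

theorem IsFace.exists_mem_dualMonoid {τ σ : Set ι} (h : IsFace vec τ σ) :
    ∃ m : dualMonoid vec σ, (∀ ρ ∈ τ, m.1 (vec ρ) = 0) ∧
      ∀ ρ ∈ σ, ρ ∉ τ → 0 < m.1 (vec ρ) := by
  obtain ⟨_, m, hm0, hm⟩ := h
  refine ⟨⟨m, fun ρ hρ => ?_⟩, hm0, hm⟩
  by_cases hc : ρ ∈ τ
  · exact (hm0 ρ hc).ge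
  · exact (hm ρ hρ hc).le

instance [Finite ι] {τ σ : FanCone vec mx} (f : τ ⟶ σ) :
    IsOpenImmersion ((charts vec mx).map f) := by
  obtain ⟨m, hm0, hm⟩ := IsFace.exists_mem_dualMonoid vec f.le
  exact (charts_map_range vec mx f m hm0 hm).1

instance [Finite ι] : (charts vec mx ⋙ Scheme.forget).IsLocallyDirected where
  cond := by
    intro i j k fi fj xi xj h
    obtain ⟨a, ha0, ha⟩ := IsFace.exists_mem_dualMonoid vec fi.le
    obtain ⟨b, hb0, hb⟩ := IsFace.exists_mem_dualMonoid vec fj.le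
    have hli : IsFace vec (i.1 ∩ j.1) i.1 := by
      refine ⟨Set.inter_subset_left, b.1, fun ρ hρ => hb0 ρ hρ.2, fun ρ hρ hc => ?_⟩
      exact hb ρ (fi.le.1 hρ) fun hj => hc ⟨hρ, hj⟩
    have hlj : IsFace vec (i.1 ∩ j.1) j.1 := by
      refine ⟨Set.inter_subset_right, a.1, fun ρ hρ => ha0 ρ hρ.1, fun ρ hρ hc => ?_⟩
      exact ha ρ (fj.le.1 hρ) fun hi => hc ⟨hi, hρ⟩
    let l : FanCone vec mx := ⟨i.1 ∩ j.1, by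
      obtain ⟨σ, hσ, hf⟩ := i.2
      exact ⟨σ, hσ, hli.trans vec hf⟩⟩
    let fli : l ⟶ i := homOfLE hli
    let flj : l ⟶ j := homOfLE hlj
    have hrange := (charts_map_range vec mx (fli ≫ fi) (a + b)
      (fun ρ hρ => by simp [ha0 ρ hρ.1, hb0 ρ hρ.2])
      (fun ρ hρ hc => by
        have ha' : 0 ≤ a.1 (vec ρ) := a.2 ρ hρ
        have hb' : 0 ≤ b.1 (vec ρ) := b.2 ρ hρ
        by_cases hi : ρ ∈ i.1
        · have := hb ρ hρ fun hj => hc ⟨hi, hj⟩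
          simp only [AddSubmonoid.coe_add, LinearMap.add_apply]
          omega
        · have := ha ρ hρ hi
          simp only [AddSubmonoid.coe_add, LinearMap.add_apply]
          omega)).2
    have hx : (charts vec mx).map fi xi = (charts vec mx).map fj xj := h
    have hxa : (charts vec mx).map fi xi ∈ PrimeSpectrum.basicOpen
        (AddMonoidAlgebra.single a (1 : ℂ) : ConeRing vec ℂ k.1) :=
      (charts_map_range vec mx fi a ha0 ha).2.le ⟨xi, rfl⟩
    have hxb : (charts vec mx).map fi xi ∈ PrimeSpectrum.basicOpen
        (AddMonoidAlgebra.single b (1 : ℂ) : ConeRing vec ℂ k.1) :=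
      (charts_map_range vec mx fj b hb0 hb).2.le ⟨xj, hx.symm⟩
    have hxab : (charts vec mx).map fi xi ∈ PrimeSpectrum.basicOpen
        (AddMonoidAlgebra.single (a + b) (1 : ℂ) : ConeRing vec ℂ k.1) := by
      have : (AddMonoidAlgebra.single (a + b) (1 : ℂ) : ConeRing vec ℂ k.1) =
          AddMonoidAlgebra.single a 1 * AddMonoidAlgebra.single b 1 := by
        rw [AddMonoidAlgebra.single_mul_single, one_mul]
      rw [this, PrimeSpectrum.basicOpen_mul]
      exact ⟨hxa, hxb⟩
    obtain ⟨y, hy⟩ := hrange.ge hxab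
    have hyi : (charts vec mx).map fi ((charts vec mx).map fli y) =
        (charts vec mx).map fi xi := by
      rw [← hy, Functor.map_comp, Scheme.Hom.comp_apply]
    have hyj : (charts vec mx).map fj ((charts vec mx).map flj y) =
        (charts vec mx).map fj xj := by
      rw [← hx, ← hy, ← Scheme.Hom.comp_apply, ← Functor.map_comp]
      rfl
    exact ⟨l, fli, flj, y, ((charts vec mx).map fi).isOpenEmbedding.injective hyi,
      ((charts vec mx).map fj).isOpenEmbedding.injective hyj⟩

/-- The toric variety `ℙ_Σ` over `ℂ`: the affine toric varieties `U_σ = Spec ℂ[σ^∨ ∩ M]` glued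
along common faces. -/
def toricVariety [Finite ι] : Scheme.{0} := colimit (charts vec mx)

/-- The open immersion `U_σ → ℙ_Σ`. -/
def chart [Finite ι] (σ : FanCone vec mx) :
    Spec (.of (ConeRing vec ℂ σ.1)) ⟶ toricVariety vec mx :=
  colimit.ι (charts vec mx) σ

/-- The structure morphism `ℙ_Σ → Spec ℂ`. -/
def structureMap [Finite ι] : toricVariety vec mx ⟶ Spec (.of ℂ) :=
  colimit.desc (charts vec mx)
    { pt := Spec (.of ℂ)
      ι :=
        { app := fun σ => Spec.map (CommRingCat.ofHom (algebraMap ℂ (ConeRing vec ℂ σ.1)))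
          naturality := fun τ σ f => by
            change Spec.map _ ≫ Spec.map _ = Spec.map _ ≫ 𝟙 _
            rw [Category.comp_id, ← Spec.map_comp, ← CommRingCat.ofHom_comp]
            congr 2
            ext r
            simp [faceMap] } }

theorem chart_structureMap [Finite ι] (σ : FanCone vec mx) :
    chart vec mx σ ≫ structureMap vec mx =
      Spec.map (CommRingCat.ofHom (algebraMap ℂ (ConeRing vec ℂ σ.1))) :=
  colimit.ι_desc _ _

/-! ### Families of closed subschemes over an affine base -/

variable (R : Type) [CommRing R] [Algebra ℂ R]

/-- The product `ℙ_Σ × S` over `Spec ℂ`, where `S = Spec R`. -/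
def total [Finite ι] : Scheme.{0} :=
  pullback (structureMap vec mx) (Spec.map (CommRingCat.ofHom (algebraMap ℂ R)))

/-- The projection `ℙ_Σ × S → ℙ_Σ`. -/
def total.fst [Finite ι] : total vec mx R ⟶ toricVariety vec mx := pullback.fst _ _

/-- The projection `ℙ_Σ × S → S`. -/
def total.snd [Finite ι] : total vec mx R ⟶ Spec (.of R) := pullback.snd _ _

/-- The chart `U_σ × S = Spec R[σ^∨ ∩ M] → ℙ_Σ × S`. -/
def chartOver [Finite ι] (σ : FanCone vec mx) :
    Spec (.of (ConeRing vec R σ.1)) ⟶ total vec mx R :=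
  pullback.lift
    (Spec.map (CommRingCat.ofHom
      (AddMonoidAlgebra.mapRingHom (dualMonoid vec σ.1) (algebraMap ℂ R))) ≫ chart vec mx σ)
    (Spec.map (CommRingCat.ofHom (algebraMap R (ConeRing vec R σ.1)))) (by
      rw [Category.assoc, chart_structureMap, ← Spec.map_comp, ← Spec.map_comp,
        ← CommRingCat.ofHom_comp, ← CommRingCat.ofHom_comp]
      congr 2
      ext r
      simp)

/-- The map `id × φ : ℙ_Σ × Spec R → ℙ_Σ × Spec R'` for `φ : Spec R → Spec R'` over `ℂ`. -/
def totalMap [Finite ι] {R R' : Type} [CommRing R] [Algebra ℂ R] [CommRing R'] [Algebra ℂ R']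
    (φ : R' →ₐ[ℂ] R) : total vec mx R ⟶ total vec mx R' :=
  pullback.lift (total.fst vec mx R)
    (total.snd vec mx R ≫ Spec.map (CommRingCat.ofHom φ.toRingHom)) (by
      rw [Category.assoc, ← Spec.map_comp, ← CommRingCat.ofHom_comp]
      have h : φ.toRingHom.comp (algebraMap ℂ R') = algebraMap ℂ R := φ.comp_algebraMap
      rw [h]
      exact pullback.condition)

/-- The Cox ring `R[x_ρ]` inside its localization `R[x_ρ, x_ρ⁻¹] = R[ℤ^{Σ(1)}]`. -/
def coxToLaurent : MvPolynomial ι R →ₐ[R] AddMonoidAlgebra R (ι → ℤ) :=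
  open Classical in
  MvPolynomial.aeval fun ρ => AddMonoidAlgebra.single (Pi.single ρ (1 : ℤ)) (1 : R)

/-- The identification of `R[σ^∨ ∩ M]` with the degree zero part of the localized Cox ring
`R[x_ρ][1 / x_ρ : ρ ∉ σ]`: `χ^m ↦ ∏_ρ x_ρ^{⟨m, ρ⟩}`. -/
def chartToCox (σ : Set ι) : ConeRing vec R σ →+* AddMonoidAlgebra R (ι → ℤ) :=
  AddMonoidAlgebra.mapDomainRingHom R
    { toFun := fun m ρ => m.1 (vec ρ)
      map_zero' := rfl
      map_add' := fun _ _ => rfl }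

/-- The ideal of `V(s) ∩ U_σ` for a finite family `s` of homogeneous elements of the Cox ring:
with `I` the ideal generated by the `s i`, it is the degree zero part of
`I[1 / x_ρ : ρ ∉ σ]`, i.e. it is generated by the elements `x^b * s i` of degree zero, where `b`
is an exponent vector with `b ρ ≥ 0` for `ρ ∈ σ`. -/
def chartIdeal {κ : Type} (s : κ → MvPolynomial ι R) (σ : Set ι) : Ideal (ConeRing vec R σ) :=
  Ideal.span {g | ∃ (i : κ) (b : ι → ℤ), (∀ ρ ∈ σ, 0 ≤ b ρ) ∧
    chartToCox vec R σ g = AddMonoidAlgebra.single b 1 * coxToLaurent R (s i)}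

/-- The ideal sheaf on `ℙ_Σ × S` of the functions whose restriction to each chart `U_σ × S`
lies in the ideal `chartIdeal`. -/
def zeroIdeal [Finite ι] {κ : Type} (s : κ → MvPolynomial ι R) :
    (total vec mx R).IdealSheafData :=
  ⨅ σ : FanCone vec mx, (Spec.map (CommRingCat.ofHom
    (Ideal.Quotient.mk (chartIdeal vec R s σ.1))) ≫ chartOver vec mx R σ).ker

/-- The closed subscheme `V(s) ⊆ ℙ_Σ × S`, the common zero scheme of the sections `s i`
given by homogeneous elements of the Cox ring with coefficients in `R`. -/
def zeroScheme [Finite ι] {κ : Type} (s : κ → MvPolynomial ι R) : Scheme.{0} :=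
  (zeroIdeal vec mx R s).subscheme

/-- The closed immersion `V(s) → ℙ_Σ × S`. -/
def zeroScheme.incl [Finite ι] {κ : Type} (s : κ → MvPolynomial ι R) :
    zeroScheme vec mx R s ⟶ total vec mx R :=
  (zeroIdeal vec mx R s).subschemeι

/-- The structure morphism of `V(s)` as a family over `S`. -/
def zeroScheme.toBase [Finite ι] {κ : Type} (s : κ → MvPolynomial ι R) :
    zeroScheme vec mx R s ⟶ Spec (.of R) :=
  zeroScheme.incl vec mx R s ≫ total.snd vec mx R

variable {mx}

/-- The torus `𝕋_N × S = Spec R[M] → ℙ_Σ × S`, the chart of the cone `{0}`. -/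
def torusOver [Finite ι] (h : ∃ σ ∈ mx, IsFace vec ∅ σ) :
    Spec (.of (AddMonoidAlgebra R (Module.Dual ℤ N))) ⟶ total vec mx R :=
  Spec.map (CommRingCat.ofHom (AddMonoidAlgebra.mapDomainRingHom R (dualMonoid vec ∅).subtype)) ≫
    chartOver vec mx R ⟨∅, h⟩

/-- The translation of `𝕋_N × S` by an `S`-point `c` of the torus `𝕋_N = Hom(M, 𝔾_m)`,
given on functions by `χ^m ↦ c(m) χ^m`. -/
def translation (c : Multiplicative (Module.Dual ℤ N) →* Rˣ) :
    Spec (.of (AddMonoidAlgebra R (Module.Dual ℤ N))) ⟶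
      Spec (.of (AddMonoidAlgebra R (Module.Dual ℤ N))) :=
  Spec.map (CommRingCat.ofHom (AddMonoidAlgebra.lift R
    (AddMonoidAlgebra R (Module.Dual ℤ N)) (Module.Dual ℤ N)
    { toFun := fun m => AddMonoidAlgebra.single m.toAdd (c m : R)
      map_one' := by simp [AddMonoidAlgebra.one_def]
      map_mul' := fun m m' => by simp [AddMonoidAlgebra.single_mul_single] }).toRingHom)

/-- The family `V(s)` over `S = Spec R` is, up to the automorphism of `ℙ_Σ × S` over `S`
that extends the translation of `𝕋_N × S` by `c`, the pullback of the family `V(s')` over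
`S' = Spec R'` along the morphism `φ : S → S'`. -/
def IsPullbackUpToTorus [Finite ι] (h : ∃ σ ∈ mx, IsFace vec ∅ σ) {κ : Type}
    {R R' : Type} [CommRing R] [Algebra ℂ R] [CommRing R'] [Algebra ℂ R']
    (φ : R' →ₐ[ℂ] R) (c : Multiplicative (Module.Dual ℤ N) →* Rˣ)
    (s : κ → MvPolynomial ι R) (s' : κ → MvPolynomial ι R') : Prop :=
  ∃ Φ : total vec mx R ≅ total vec mx R,
    Φ.hom ≫ total.snd vec mx R = total.snd vec mx R ∧
    torusOver vec R h ≫ Φ.hom = translation R c ≫ torusOver vec R h ∧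
    ∃ g : zeroScheme vec mx R s ⟶ zeroScheme vec mx R' s',
      IsPullback g (zeroScheme.incl vec mx R s) (zeroScheme.incl vec mx R' s')
        (Φ.hom ≫ totalMap vec mx φ) ∧
      IsPullback g (zeroScheme.toBase vec mx R s) (zeroScheme.toBase vec mx R' s')
        (Spec.map (CommRingCat.ofHom φ.toRingHom))

end Fan

end Toric

/-! ### The fan `Π` -/

namespace BB

/-- The lattice `N = {x ∈ ℤ⁶ : x₁ + ⋯ + x₆ = 0}` (indices run over `0, …, 5` here). -/
abbrev N : Type := LinearMap.ker (∑ i : Fin 6, LinearMap.proj (R := ℤ) (φ := fun _ => ℤ) i)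

/-- The dual lattice `M = Hom(N, ℤ) = ℤ⁶ / ℤ(1, …, 1)`. -/
abbrev M : Type := Module.Dual ℤ N

/-- The coordinate `t_i ∈ M` on the torus, the class of `e_i`; in multiplicative notation
`t_1 ⋯ t_6 = 1`. -/
def t (i : Fin 6) : M := (LinearMap.proj i).comp (Submodule.subtype _)

/-- Indices of the rays: `Sum.inl (i₁, i₂, i₃)` stands for `u_{i₁i₂i₃}`, with
`i₁ ≤ i₂ ≤ i₃` and `(i₁, i₂, i₃) ≠ (1, 2, 3)`, and `Sum.inr (i₁, i₂, i₃)` for `v_{i₁i₂i₃}`,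
with `i₁ ≤ i₂ ≤ i₃` and `(i₁, i₂, i₃) ≠ (4, 5, 6)`. -/
abbrev Ray : Type :=
  {i : Fin 3 → Fin 6 // Monotone i ∧ i ≠ ![0, 1, 2]} ⊕
    {i : Fin 3 → Fin 6 // Monotone i ∧ i ≠ ![3, 4, 5]}

/-- The triple `(i₁, i₂, i₃)` of a ray. -/
def Ray.triple : Ray → Fin 3 → Fin 6
  | .inl i => i.1
  | .inr i => i.1

/-- The base point of the rays: `e_1 + e_2 + e_3` for `u` and `e_4 + e_5 + e_6` for `v`. -/
def Ray.origin : Ray → Fin 3 → Fin 6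
  | .inl _ => ![0, 1, 2]
  | .inr _ => ![3, 4, 5]

/-- The ray generators `u_{i₁i₂i₃} = e_{i₁} + e_{i₂} + e_{i₃} - e_1 - e_2 - e_3` and
`v_{i₁i₂i₃} = e_{i₁} + e_{i₂} + e_{i₃} - e_4 - e_5 - e_6`. -/
def vec (ρ : Ray) : N :=
  ⟨∑ l, Pi.single (ρ.triple l) 1 - ∑ l, Pi.single (ρ.origin l) 1, by
    simp [LinearMap.mem_ker, Finset.sum_sub_distrib, Finset.sum_apply, Finset.sum_comm (s := (Finset.univ : Finset (Fin 6)))]⟩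

/-- The colour scheme of the 3-fold edgewise subdivision of a `d`-simplex: a `3 × (d+1)` matrix
filled row by row with `0, …, d` in weakly increasing order, where for each `c < d` the value
jumps by one between the columns `c` and `c + 1` in exactly one row, namely `r c`. -/
def color {d : ℕ} (r : Fin d → Fin 3) (row : Fin 3) (col : Fin (d + 1)) : Fin (d + 1) :=
  ⟨(Finset.univ.filter fun c : Fin d => r c < row ∨ (r c = row ∧ c.castSucc < col)).card,
    Nat.lt_succ_of_le ((Finset.card_filter_le _ _).trans (by simp))⟩

/-- For the simplex `conv(u_{kkk} : k ∈ range e)` with ordered vertices, the ray `u` through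
the vertex of the edgewise subdivision given by the column `c` of the colour scheme of `r`. -/
def IsU {d : ℕ} (e : Fin (d + 1) ↪o Fin 6) (r : Fin d → Fin 3) (c : Fin (d + 1)) (ρ : Ray) :
    Prop :=
  ∃ h, ρ = .inl ⟨fun row => e (color r row c), h⟩

/-- The same for `conv(v_{kkk} : k ∈ range e)`. -/
def IsV {d : ℕ} (e : Fin (d + 1) ↪o Fin 6) (r : Fin d → Fin 3) (c : Fin (d + 1)) (ρ : Ray) :
    Prop :=
  ∃ h, ρ = .inr ⟨fun row => e (color r row c), h⟩

/-- The maximal cones of `Π`: the cones over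
* the maximal simplices of `Esd₃(conv(u_{kkk} : k ≠ i))`, `1 ≤ i ≤ 3`,
* the maximal simplices of `Esd₃(conv(v_{kkk} : k ≠ j))`, `4 ≤ j ≤ 6`,
* for `1 ≤ i ≤ 3`, `4 ≤ j ≤ 6`, the maximal simplices
  `conv(p_0, …, p_q, p_q + w, …, p_3 + w)` of the prisms over the maximal simplices
  `conv(p_0, …, p_3)` of `Esd₃(conv(u_{kkk} : k ≠ i, j))`, where
  `w = e_1 + e_2 + e_3 - e_4 - e_5 - e_6`, so that `u_{abc} + w = v_{abc}`. -/
def maxCones : Set (Set Ray) :=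
  {σ | ∃ (i : Fin 6) (e : Fin 5 ↪o Fin 6) (r : Fin 4 → Fin 3), i < 3 ∧ (∀ c, e c ≠ i) ∧
      σ = {ρ | ∃ c, IsU e r c ρ}} ∪
  {σ | ∃ (j : Fin 6) (e : Fin 5 ↪o Fin 6) (r : Fin 4 → Fin 3), 3 ≤ j ∧ (∀ c, e c ≠ j) ∧
      σ = {ρ | ∃ c, IsV e r c ρ}} ∪
  {σ | ∃ (i j : Fin 6) (e : Fin 4 ↪o Fin 6) (r : Fin 3 → Fin 3) (q : Fin 4),
      i < 3 ∧ 3 ≤ j ∧ (∀ c, e c ≠ i ∧ e c ≠ j) ∧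
      σ = {ρ | ∃ c, (c ≤ q ∧ IsU e r c ρ) ∨ (q ≤ c ∧ IsV e r c ρ)}}

/-- `{0}` is a cone of `Π`. -/
theorem zero_mem_fan : ∃ σ ∈ maxCones, Toric.IsFace vec ∅ σ := by
  refine ⟨{ρ | ∃ c, IsU (Fin.succAboveOrderEmb 0) (fun _ : Fin 4 => 0) c ρ},
    Or.inl (Or.inl ⟨0, _, _, by decide, fun c => Fin.succ_ne_zero c, rfl⟩),
    Set.empty_subset _, -t 0, by simp, ?_⟩
  rintro ρ ⟨c, h, rfl⟩ -
  simp [t, vec, Ray.triple, Ray.origin, Fin.sum_univ_three]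

/-! ### The families -/

variable (R : Type) [CommRing R] [Algebra ℂ R]

/-- `δ_{i₁}^k + δ_{i₂}^k + δ_{i₃}^k` for a ray with triple `(i₁, i₂, i₃)`. -/
def mult (k : Fin 6) (ρ : Ray) : ℕ := ∑ l, if ρ.triple l = k then 1 else 0

/-- The monomial `∏ v_{i₁i₂i₃}^{δ_{i₁}^k + δ_{i₂}^k + δ_{i₃}^k} ∏ u_{i₁i₂i₃}^{⋯}` of the Cox
ring `R[x_ρ]`, over all rays. -/
def mono (k : Fin 6) : MvPolynomial Ray R := ∏ ρ : Ray, MvPolynomial.X ρ ^ mult k ρ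

/-- The section `b ∏ u_{i₁i₂i₃} - ∑_{k=1}^{3} a_k ∏ v_{i₁i₂i₃}^{⋯} ∏ u_{i₁i₂i₃}^{⋯}` of
`𝒪(D₁)`, which is `b - a_1 t_1 - a_2 t_2 - a_3 t_3` in toric coordinates, and the section
`b' ∏ v_{i₁i₂i₃} - ∑_{k=4}^{6} a_k ∏ v_{i₁i₂i₃}^{⋯} ∏ u_{i₁i₂i₃}^{⋯}` of `𝒪(D₂)`, which is
`b' - a_4 t_4 - a_5 t_5 - a_6 t_6` in toric coordinates. -/
def sections (b b' : R) (a : Fin 6 → R) : Fin 2 → MvPolynomial Ray R :=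
  ![MvPolynomial.C b * ∏ i, MvPolynomial.X (.inl i) -
      ∑ k : Fin 6 with k < 3, MvPolynomial.C (a k) * mono R k,
    MvPolynomial.C b' * ∏ i, MvPolynomial.X (.inr i) -
      ∑ k : Fin 6 with 3 ≤ k, MvPolynomial.C (a k) * mono R k]

/-- The sections `s₁, s₂` of the Batyrev–Borisov family `𝒴_{ξ₁,ξ₂,a₁,…,a₆}` with parameters
in `R`. -/
def sectionsBB (ξ₁ ξ₂ : R) (a : Fin 6 → R) : Fin 2 → MvPolynomial Ray R :=
  sections R (3 * ξ₁) (3 * ξ₂) a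

/-- The coordinate ring of `ℂ - {0}`. -/
abbrev Gm : Type := LaurentPolynomial ℂ

/-- The coordinate of `ℂ - {0}` as a unit. -/
def coord : Gmˣ where
  val := LaurentPolynomial.T 1
  inv := LaurentPolynomial.T (-1)
  val_inv := by rw [← LaurentPolynomial.T_add]; simp
  inv_val := by rw [← LaurentPolynomial.T_add]; simp

variable {R} in
/-- The morphism `w : Spec R → ℂ - {0}` defined by an invertible function `w`. -/
def toGm (w : Rˣ) : Gm →ₐ[ℂ] R :=
  AddMonoidAlgebra.lift ℂ R ℤ ((Units.coeHom R).comp (zpowersHom Rˣ w))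

/-- The sections of the family `𝒴_ψ` over `ℂ - {0}` with coordinate `ψ`: all `a_i` are `1`
and `ξ₁ = ξ₂ = ψ`. -/
def sectionsPsi : Fin 2 → MvPolynomial Ray Gm := sectionsBB Gm coord coord 1

/-- The sections of the family `𝒴_z` over `ℂ - {0}` with coordinate `z`: the sections of `𝒪(D₁)`
and `𝒪(D₂)` given by `1 - t_1 - t_2 - t_3` and `1 - t_4 - t_5 - z t_6`, where
`t_6 = 1 / (t_1 ⋯ t_5)`. -/
def sectionsZ : Fin 2 → MvPolynomial Ray Gm := sections Gm 1 1 ![1, 1, 1, 1, 1, coord]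

/-- The constant `3` as a unit. -/
def three : Rˣ := Units.map (algebraMap ℂ R).toMonoidHom (Units.mk0 3 (by norm_num))

variable {R} in
/-- The pullback property of the Batyrev–Borisov family with invertible parameters
`ξ₁, ξ₂, a₁, …, a₆ ∈ R`: along `z = a_1 ⋯ a_6 / ((3ξ₁)³ (3ξ₂)³)` and up to the automorphism that
extends the change of coordinates `t_i ↦ a_i t_i / (3ξ₁)` for `i ≤ 3`, `t_i ↦ a_i t_i / (3ξ₂)` for
`i = 4, 5` of the torus, it is the pullback of the family `𝒴_z`. -/
def IsPullbackOfZ (ξ₁ ξ₂ : Rˣ) (a : Fin 6 → Rˣ) : Prop :=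
  ∃ c : Multiplicative M →* Rˣ,
    (∀ i : Fin 6, i < 3 → c (.ofAdd (t i)) = a i / (three R * ξ₁)) ∧
    (∀ i : Fin 6, i = 3 ∨ i = 4 → c (.ofAdd (t i)) = a i / (three R * ξ₂)) ∧
    Toric.IsPullbackUpToTorus vec zero_mem_fan
      (toGm ((∏ i, a i) / ((three R * ξ₁) ^ 3 * (three R * ξ₂) ^ 3))) c
      (sectionsBB R ξ₁ ξ₂ fun i => a i) sectionsZ

/-! ### The parameter space `U₁ × U₂` -/

attribute [local instance] MvPolynomial.gradedAlgebra

/-- The homogeneous coordinate ring of `ℙ³`. -/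
abbrev P3 : Type := MvPolynomial (Fin 4) ℂ

theorem prod_mem_deg (i : Fin 4) (j : Fin 4) :
    (MvPolynomial.X i * ∏ k ∈ Finset.univ.erase j, MvPolynomial.X k : P3) ∈
      MvPolynomial.homogeneousSubmodule (Fin 4) ℂ (1 • 4) := by
  have h := (MvPolynomial.isHomogeneous_X ℂ i).mul
    (MvPolynomial.IsHomogeneous.prod (Finset.univ.erase j) (fun k : Fin 4 => (MvPolynomial.X k : P3))
      (fun _ => 1) fun k _ => MvPolynomial.isHomogeneous_X ℂ k)
  simpa using h

theorem prod_mem_four :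
    (∏ k, MvPolynomial.X k : P3) ∈ MvPolynomial.homogeneousSubmodule (Fin 4) ℂ 4 := by
  have h := MvPolynomial.IsHomogeneous.prod Finset.univ
    (fun k : Fin 4 => (MvPolynomial.X k : P3)) (fun _ => 1)
    fun k _ => MvPolynomial.isHomogeneous_X ℂ k
  simpa using h

/-- The coordinate ring of the affine open subset `{x₀ ≠ 0, x₁ ≠ 0, x₂ ≠ 0, x₃ ≠ 0}` of `ℙ³`,
the degree zero part of `ℂ[x₀, x₁, x₂, x₃, 1 / (x₀ x₁ x₂ x₃)]`. -/
abbrev U : Type :=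
  HomogeneousLocalization.Away (MvPolynomial.homogeneousSubmodule (Fin 4) ℂ)
    (∏ k, MvPolynomial.X k : P3)

instance : Algebra ℂ U where
  algebraMap := (HomogeneousLocalization.fromZeroRingHom
    (MvPolynomial.homogeneousSubmodule (Fin 4) ℂ) _).comp
      (algebraMap ℂ (MvPolynomial.homogeneousSubmodule (Fin 4) ℂ 0))
  commutes' := fun _ _ => mul_comm _ _
  smul_def' := fun r x => by
    obtain ⟨n, y, hy, rfl⟩ := HomogeneousLocalization.Away.mk_surjective _ prod_mem_four x
    apply HomogeneousLocalization.val_injective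
    rw [HomogeneousLocalization.val_smul, HomogeneousLocalization.val_mul,
      HomogeneousLocalization.Away.val_mk, Localization.smul_mk, Algebra.smul_def]
    change _ = Localization.mk (algebraMap ℂ P3 r) 1 * _
    rw [Localization.mk_mul, one_mul]

/-- The function `x_i / x_j` on this subset. -/
def ratio (i j : Fin 4) : U :=
  HomogeneousLocalization.Away.mk _ prod_mem_four 1
    (MvPolynomial.X i * ∏ k ∈ Finset.univ.erase j, MvPolynomial.X k) (prod_mem_deg i j)

theorem ratio_mul_ratio (i j : Fin 4) : ratio i j * ratio j i = 1 := by
  apply HomogeneousLocalization.val_injective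
  simp only [HomogeneousLocalization.val_mul, ratio, HomogeneousLocalization.Away.val_mk,
    HomogeneousLocalization.val_one, Localization.mk_mul]
  rw [← Localization.mk_one, Localization.mk_eq_mk_iff, Localization.r_iff_exists]
  refine ⟨1, ?_⟩
  have h1 := Finset.mul_prod_erase Finset.univ (fun k => (MvPolynomial.X k : P3))
    (Finset.mem_univ i)
  have h2 := Finset.mul_prod_erase Finset.univ (fun k => (MvPolynomial.X k : P3))
    (Finset.mem_univ j)
  simp only [Submonoid.coe_mul, Submonoid.coe_one, one_mul, mul_one, pow_one]
  rw [mul_mul_mul_comm, mul_comm (∏ k ∈ Finset.univ.erase j, _), ← mul_mul_mul_comm, h1, h2]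

/-- The invertible function `x_i / x_0`. -/
def ratioUnit (i : Fin 4) : Uˣ := ⟨ratio i 0, ratio 0 i, ratio_mul_ratio i 0, ratio_mul_ratio 0 i⟩

/-- The coordinate ring of `U₁ × U₂`. -/
abbrev U₁₂ : Type := U ⊗[ℂ] U

/-- The functions `a_1 / ξ₁, a_2 / ξ₁, a_3 / ξ₁, a_4 / ξ₂, a_5 / ξ₂, a_6 / ξ₂` on `U₁ × U₂`, where
`(ξ₁, a_1, a_2, a_3)` and `(ξ₂, a_4, a_5, a_6)` are the homogeneous coordinates of the factors. -/
def a : Fin 6 → U₁₂ˣ :=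
  let l : U →* U₁₂ := (Algebra.TensorProduct.includeLeft : U →ₐ[ℂ] U₁₂)
  let r : U →* U₁₂ := (Algebra.TensorProduct.includeRight : U →ₐ[ℂ] U₁₂)
  ![Units.map l (ratioUnit 1), Units.map l (ratioUnit 2), Units.map l (ratioUnit 3),
    Units.map r (ratioUnit 1), Units.map r (ratioUnit 2), Units.map r (ratioUnit 3)]

end BB

end

namespace Toric

/-! ### Ideal sheaves and open covers -/

section IdealSheaf

open Scheme

/-! Write b = 3ξ₁ and b' = 3ξ₂. On the torus the statement is a substitution: t_i ↦ (a_i/b) t_i for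
i ≤ 3 turns 1 - t₁ - t₂ - t₃ into b⁻¹(b - a₁t₁ - a₂t₂ - a₃t₃). With t_i ↦ (a_i/b') t_i for i = 4, 5,
the relation t₁⋯t₆ = 1 forces t₆ to be scaled by b³b'²/(a₁⋯a₅), and z = a₁⋯a₆/(b³b'³) is exactly the
value for which z t₆ becomes (a₆/b') t₆. So each section of 𝒴_z goes to a unit multiple of the
section wanted (`isPullbackOfZ`).

The work lies in carrying this over the boundary as an equality of schemes. A translation multiplies
χ^m by a unit c(m), so it preserves every chart ring R[σ^∨ ∩ M] and glues to ℙ × S. A section has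
the form x^d F with F a Laurent polynomial with invertible constant term. This makes the degree zero
multiples of the section identifiable: the ideal on the chart of σ is generated by the χ^m F with m
≥ d on σ (`IsLaurentForm.chartIdeal_eq`). The twist maps these generators to unit multiples of the
corresponding ones (`IsLaurentForm.map_chartIdeal`), so the ideals agree chart by chart.

The global ideal sheaf is an infimum over charts. It restricts to the given ideal on each chart
(`zeroIdeal_comap_incl`) because the chart ideals agree along faces (`map_faceMap_chartIdeal`) and
compatible ideals on a finite locally directed cover glue (`comap_iInf_map`). Equality of ideal
sheaves then yields the cartesian squares (`isPullbackUpToTorus_of_map_chartIdeal`), and restriction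
to the chart of {0} gives the equations on the torus. -/

theorem isPushout_quotient_map {A B : Type} [CommRing A] [CommRing B] (θ : A →+* B)
    (I : Ideal A) :
    IsPushout (CommRingCat.ofHom θ) (CommRingCat.ofHom (Ideal.Quotient.mk I))
      (CommRingCat.ofHom (Ideal.Quotient.mk (I.map θ)))
      (CommRingCat.ofHom (Ideal.quotientMap (I.map θ) θ Ideal.le_comap_map)) := by
  refine ⟨⟨?_⟩, ⟨PushoutCocone.IsColimit.mk _
    (fun s => CommRingCat.ofHom (Ideal.Quotient.lift (I.map θ) s.inl.hom ?_)) ?_ ?_ ?_⟩⟩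
  · ext x
    simp
  · have h : I.map θ ≤ RingHom.ker s.inl.hom := by
      refine Ideal.map_le_iff_le_comap.mpr fun x hx => ?_
      have h1 := congr($(s.condition) x)
      simp only [CommRingCat.hom_comp, CommRingCat.hom_ofHom, RingHom.comp_apply] at h1
      rw [Ideal.mem_comap, RingHom.mem_ker, h1, Ideal.Quotient.eq_zero_iff_mem.mpr hx, map_zero]
    exact fun x hx => h hx
  · intro s
    ext x
    rfl
  · intro s
    ext x
    exact congr($(s.condition) x)
  · intro s m h1 h2
    ext x
    exact congr($h1 x)

/-- The base change of Spec A/I along θ is Spec B/IB, and pulling back the ideal of a closed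
immersion gives the ideal of its base change. All later comparisons on affine charts become
computations with `Ideal.map` through this. -/
theorem comap_ker_specMap_quotient {A B : Type} [CommRing A] [CommRing B] (θ : A →+* B)
    (I : Ideal A) :
    (Spec.map (CommRingCat.ofHom (Ideal.Quotient.mk I))).ker.comap
        (Spec.map (CommRingCat.ofHom θ)) =
      (Spec.map (CommRingCat.ofHom (Ideal.Quotient.mk (I.map θ)))).ker := by
  have : IsClosedImmersion (Spec.map (CommRingCat.ofHom (Ideal.Quotient.mk I))) :=
    IsClosedImmersion.spec_of_surjective _ Ideal.Quotient.mk_surjective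
  have h := isPullback_SpecMap_of_isPushout _ _ _ _ (isPushout_quotient_map θ I)
  rw [← IdealSheafData.ker_fst_of_isClosedImmersion, ← h.isoPullback_hom_fst,
    Hom.ker_comp_of_isIso]

variable {X Y Z : Scheme.{0}}

theorem exists_isPullback_subschemeι (I : Y.IdealSheafData) (f : X ⟶ Y) (i : Z ⟶ X)
    [IsClosedImmersion i] (h : I.comap f = i.ker) :
    ∃ g, IsPullback g i I.subschemeι f := by
  have hle : I.subschemeι.ker ≤ (i ≫ f).ker := by
    rw [IdealSheafData.ker_subschemeι, Hom.ker_comp, IdealSheafData.le_map_iff_comap_le, h]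
  refine ⟨IsClosedImmersion.lift I.subschemeι (i ≫ f) hle,
    (isPullback_of_isClosedImmersion i I.subschemeι _ f
      (IsClosedImmersion.lift_fac _ _ _).symm ?_).flip⟩
  rw [IdealSheafData.ker_subschemeι, h]

theorem ker_snd_subschemeι (I : Y.IdealSheafData) (f : X ⟶ Y) :
    (pullback.snd I.subschemeι f).ker = I.comap f := by
  rw [IdealSheafData.comap, ← Hom.ker_comp_of_isIso (pullbackSymmetry f I.subschemeι).hom,
    pullbackSymmetry_hom_comp_snd]

variable (𝒰 : X.OpenCover)

/-- A function belongs to I as soon as its restrictions to the members of the cover do: this is the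
computation of a kernel on an open cover, applied to the closed immersion cut out by I. -/
theorem iInf_map_comap (I : X.IdealSheafData) :
    ⨅ i, (I.comap (𝒰.f i)).map (𝒰.f i) = I := by
  conv_rhs => rw [← I.ker_subschemeι,
    ← Hom.iInf_ker_openCover_map_comp I.subschemeι (𝒰.pullback₁ I.subschemeι)]
  refine iInf_congr fun i => ?_
  change _ = (pullback.fst I.subschemeι (𝒰.f i) ≫ I.subschemeι).ker
  rw [pullback.condition, Hom.ker_comp, ker_snd_subschemeι]

theorem idealSheaf_ext_of_openCover {I J : X.IdealSheafData}
    (h : ∀ i, I.comap (𝒰.f i) = J.comap (𝒰.f i)) : I = J := by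
  rw [← iInf_map_comap 𝒰 I, ← iInf_map_comap 𝒰 J]
  simp_rw [h]

theorem comap_ker_of_isOpenImmersion (f : X ⟶ Y) [IsOpenImmersion f] (i : Z ⟶ Y)
    [QuasiCompact i] : i.ker.comap f = (pullback.fst f i).ker := by
  ext U : 2
  rw [ker_ideal_of_isPullback_of_isOpenImmersion i (pullback.fst f i) (pullback.snd f i) f
    (IsPullback.of_hasPullback f i), IdealSheafData.ideal_comap_of_isOpenImmersion]

/-- The nontrivial inclusion says that a function in J j vanishes on the part of V(J i) inside the
j-th member, for every i. The overlap of the members i and j is covered by members k mapping to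
both, and there J i and J j have the same restriction J k. -/
theorem comap_iInf_map [Category* 𝒰.I₀] [𝒰.LocallyDirected] [Finite 𝒰.I₀]
    [∀ i, QuasiCompact (𝒰.f i)] (J : ∀ i, (𝒰.X i).IdealSheafData)
    (hJ : ∀ {i j : 𝒰.I₀} (f : i ⟶ j), (J j).comap (𝒰.trans f) = J i) (j : 𝒰.I₀) :
    (⨅ i, (J i).map (𝒰.f i)).comap (𝒰.f j) = J j := by
  refine le_antisymm (IdealSheafData.le_map_iff_comap_le.mp (iInf_le _ j)) ?_
  have key : ∀ i, J j ≤ ((J i).map (𝒰.f i)).comap (𝒰.f j) := fun i => by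
    rw [IdealSheafData.map, comap_ker_of_isOpenImmersion]
    -- P is the part of V(J i) inside the j-th member, and q is its map to the overlap of the two
    -- members.
    let P := pullback (𝒰.f j) ((J i).subschemeι ≫ 𝒰.f i)
    let q : P ⟶ pullback (𝒰.f j) (𝒰.f i) :=
      pullback.lift (pullback.fst _ _) (pullback.snd _ _ ≫ (J i).subschemeι)
        (by rw [pullback.condition, Category.assoc])
    have hq : pullback.fst (𝒰.f j) ((J i).subschemeι ≫ 𝒰.f i) = q ≫ pullback.fst _ _ :=
      (pullback.lift_fst _ _ _).symm
    -- The kernel can be tested on the cover of P pulled back from the members k that cover the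
    -- overlap.
    rw [← Hom.iInf_ker_openCover_map_comp _
      ((𝒰.intersectionOfLocallyDirected j i).pullback₁ q)]
    refine le_iInf fun ⟨k, fj, fi⟩ => ?_
    let c : 𝒰.X k ⟶ pullback (𝒰.f j) (𝒰.f i) :=
      pullback.lift (𝒰.trans fj) (𝒰.trans fi) (by simp)
    change J j ≤ (pullback.fst q c ≫ _).ker
    have h1 : pullback.fst q c ≫ pullback.fst (𝒰.f j) ((J i).subschemeι ≫ 𝒰.f i) =
        pullback.snd q c ≫ 𝒰.trans fj := by
      rw [hq, pullback.condition_assoc, pullback.lift_fst]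
    have h2 : pullback.snd q c ≫ 𝒰.trans fi =
        (pullback.fst q c ≫ pullback.snd _ _) ≫ (J i).subschemeι := by
      have : 𝒰.trans fi = c ≫ pullback.snd _ _ := (pullback.lift_snd _ _ _).symm
      rw [this, ← pullback.condition_assoc, Category.assoc, pullback.lift_snd]
    -- On the piece indexed by k, J j is exchanged for J k and then for J i, which vanishes on V(J
    -- i).
    rw [h1, Hom.ker_comp, IdealSheafData.le_map_iff_comap_le, hJ, ← hJ fi,
      ← IdealSheafData.le_map_iff_comap_le, ← Hom.ker_comp, h2]
    exact ((J i).ker_subschemeι).ge.trans (Hom.le_ker_comp _ _)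
  intro U
  rw [IdealSheafData.ideal_comap_of_isOpenImmersion, IdealSheafData.ideal_iInf, iInf_apply,
    Ideal.comap_iInf]
  refine le_iInf fun i => ?_
  rw [← IdealSheafData.ideal_comap_of_isOpenImmersion]
  exact key i U

/-- Each overlap of two members is covered by affine members k over both; thinness leaves at most
one pair of arrows per k, so finitely many affines suffice. -/
theorem quasiCompact_of_locallyDirected [Category* 𝒰.I₀] [𝒰.LocallyDirected] [Finite 𝒰.I₀]
    [Quiver.IsThin 𝒰.I₀] [∀ i, IsAffine (𝒰.X i)] (i : 𝒰.I₀) : QuasiCompact (𝒰.f i) := by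
  refine (@HasAffineProperty.iff_of_openCover _ _
    instHasAffinePropertyQuasiCompactCompactSpaceCarrierCarrierCommRingCat _ _ _ 𝒰 _).mpr ?_
  intro j
  let 𝒱 := 𝒰.intersectionOfLocallyDirected i j
  have : Finite 𝒱.I₀ :=
    inferInstanceAs (Finite (Σ k : 𝒰.I₀, (k ⟶ i) × (k ⟶ j)))
  have h : ∀ k, CompactSpace (𝒱.X k) := fun k =>
    inferInstanceAs (CompactSpace (𝒰.X k.1))
  exact OpenCover.compactSpace 𝒱

end IdealSheaf

end Toric

namespace Toric

/-! ### The cover of `ℙ_Σ × S` by the charts -/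

section Cover

variable {N : Type} [AddCommGroup N] {ι : Type} (vec : ι → N) (mx : Set (Set ι))
variable (R : Type) [CommRing R]

theorem mapRingHom_comp_faceMap {R' : Type} [CommRing R'] (φ : R' →+* R) {τ σ : Set ι}
    (h : IsFace vec τ σ) :
    (AddMonoidAlgebra.mapRingHom (dualMonoid vec τ) φ).comp (faceMap vec R' h) =
      (faceMap vec R h).comp (AddMonoidAlgebra.mapRingHom (dualMonoid vec σ) φ) :=
  AddMonoidAlgebra.mapRingHom_comp_mapDomainRingHom _ _

theorem faceMap_comp_algebraMap {τ σ : Set ι} (h : IsFace vec τ σ) :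
    (faceMap vec R h).comp (algebraMap R (ConeRing vec R σ)) =
      algebraMap R (ConeRing vec R τ) := by
  ext r
  simp [faceMap]

open scoped AlgebraMonoidAlgebra in
-- The underlying pushout is R[S] = R ⊗ ℂ[S] for the monoid S = σ^∨ ∩ M.
theorem isPullback_algebraMap_coneRing [Algebra ℂ R] (σ : Set ι) :
    IsPullback (Spec.map (CommRingCat.ofHom (algebraMap R (ConeRing vec R σ))))
      (Spec.map (CommRingCat.ofHom
        (AddMonoidAlgebra.mapRingHom (dualMonoid vec σ) (algebraMap ℂ R))))
      (Spec.map (CommRingCat.ofHom (algebraMap ℂ R)))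
      (Spec.map (CommRingCat.ofHom (algebraMap ℂ (ConeRing vec ℂ σ)))) := by
  have : IsScalarTower ℂ (ConeRing vec ℂ σ) (ConeRing vec R σ) :=
    IsScalarTower.of_algebraMap_eq fun r => by simp
  exact isPullback_SpecMap_of_isPushout _ _ _ _
    (CommRingCat.isPushout_of_isPushout ℂ R (ConeRing vec ℂ σ) (ConeRing vec R σ))

variable [Finite ι]

/-- The chart `U_σ × S` as a scheme. -/
noncomputable def chartScheme (σ : FanCone vec mx) : Scheme.{0} := Spec (.of (ConeRing vec R σ.1))

namespace chartScheme

instance isAffine (σ : FanCone vec mx) : IsAffine (chartScheme vec mx R σ) :=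
  inferInstanceAs (IsAffine (Spec (.of (ConeRing vec R σ.1))))

/-- The projection `U_σ × S → S`. -/
noncomputable def toBase (σ : FanCone vec mx) : chartScheme vec mx R σ ⟶ Spec (.of R) :=
  Spec.map (CommRingCat.ofHom (algebraMap R (ConeRing vec R σ.1)))

/-- The inclusion `U_τ × S → U_σ × S` for a face `τ` of `σ`. -/
noncomputable def face {τ σ : FanCone vec mx} (f : τ ⟶ σ) :
    chartScheme vec mx R τ ⟶ chartScheme vec mx R σ :=
  Spec.map (CommRingCat.ofHom (faceMap vec R f.le))

theorem face_toBase {τ σ : FanCone vec mx} (f : τ ⟶ σ) :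
    face vec mx R f ≫ toBase vec mx R σ = toBase vec mx R τ := by
  change Spec.map _ ≫ Spec.map _ = Spec.map _
  rw [← Spec.map_comp, ← CommRingCat.ofHom_comp, faceMap_comp_algebraMap]

end chartScheme

variable [Algebra ℂ R]

variable {vec mx R} in
theorem total_hom_ext {T : Scheme.{0}} {f g : T ⟶ total vec mx R}
    (h₁ : f ≫ total.fst vec mx R = g ≫ total.fst vec mx R)
    (h₂ : f ≫ total.snd vec mx R = g ≫ total.snd vec mx R) : f = g :=
  pullback.hom_ext h₁ h₂

namespace chartScheme

/-- The inclusion `U_σ × S → ℙ_Σ × S`. -/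
noncomputable def incl (σ : FanCone vec mx) : chartScheme vec mx R σ ⟶ total vec mx R :=
  chartOver vec mx R σ

/-- The inclusion `U_σ → ℙ_Σ`. -/
noncomputable def chartι (σ : FanCone vec mx) : (charts vec mx).obj σ ⟶ toricVariety vec mx :=
  colimit.ι (charts vec mx) σ

instance (σ : FanCone vec mx) : IsOpenImmersion (chartι vec mx σ) :=
  inferInstanceAs (IsOpenImmersion (colimit.ι (charts vec mx) σ))

theorem map_chartι {τ σ : FanCone vec mx} (f : τ ⟶ σ) :
    (charts vec mx).map f ≫ chartι vec mx σ = chartι vec mx τ :=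
  colimit.w (charts vec mx) f

/-- The projection `U_σ × S → U_σ`. -/
noncomputable def toChart (σ : FanCone vec mx) :
    chartScheme vec mx R σ ⟶ (charts vec mx).obj σ :=
  Spec.map (CommRingCat.ofHom
    (AddMonoidAlgebra.mapRingHom (dualMonoid vec σ.1) (algebraMap ℂ R)))

theorem incl_fst (σ : FanCone vec mx) :
    incl vec mx R σ ≫ total.fst vec mx R = toChart vec mx R σ ≫ chartι vec mx σ :=
  pullback.lift_fst _ _ _

theorem incl_snd (σ : FanCone vec mx) :
    incl vec mx R σ ≫ total.snd vec mx R = toBase vec mx R σ :=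
  pullback.lift_snd _ _ _

theorem face_toChart {τ σ : FanCone vec mx} (f : τ ⟶ σ) :
    face vec mx R f ≫ toChart vec mx R σ = toChart vec mx R τ ≫ (charts vec mx).map f := by
  change Spec.map _ ≫ Spec.map _ = Spec.map _ ≫ Spec.map _
  rw [← Spec.map_comp, ← Spec.map_comp, ← CommRingCat.ofHom_comp, ← CommRingCat.ofHom_comp,
    mapRingHom_comp_faceMap]

theorem face_incl {τ σ : FanCone vec mx} (f : τ ⟶ σ) :
    face vec mx R f ≫ incl vec mx R σ = incl vec mx R τ := by
  refine total_hom_ext ?_ ?_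
  · rw [Category.assoc, incl_fst, incl_fst, ← Category.assoc, face_toChart, Category.assoc,
      map_chartι]
  · rw [Category.assoc, incl_snd, incl_snd, face_toBase]

/-- Pasting with the square that defines ℙ_Σ × S gives the affine square R[S] = R ⊗ ℂ[S]. Openness
of the charts over S, and later their covering properties, are inherited from ℙ_Σ through this
square. -/
theorem isPullback_incl (σ : FanCone vec mx) :
    IsPullback (incl vec mx R σ) (toChart vec mx R σ)
      (total.fst vec mx R) (chartι vec mx σ) := by
  refine IsPullback.of_right (h₁₂ := total.snd vec mx R) (h₂₂ := structureMap vec mx)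
    (v₁₃ := Spec.map (CommRingCat.ofHom (algebraMap ℂ R))) ?_ (incl_fst vec mx R σ)
    (IsPullback.of_hasPullback _ _).flip
  rw [incl_snd]
  have h := isPullback_algebraMap_coneRing vec R σ.1
  rw [← chart_structureMap] at h
  exact h

theorem isPullback_face {τ σ : FanCone vec mx} (f : τ ⟶ σ) :
    IsPullback (face vec mx R f) (toChart vec mx R τ) (toChart vec mx R σ)
      ((charts vec mx).map f) := by
  refine IsPullback.of_right ?_ (face_toChart vec mx R f) (isPullback_incl vec mx R σ)
  rw [face_incl, map_chartι]
  exact isPullback_incl vec mx R τ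

instance (σ : FanCone vec mx) : IsOpenImmersion (incl vec mx R σ) :=
  MorphismProperty.of_isPullback (isPullback_incl vec mx R σ).flip inferInstance

instance isOpenImmersion_face {τ σ : FanCone vec mx} (f : τ ⟶ σ) :
    IsOpenImmersion (face vec mx R f) :=
  MorphismProperty.of_isPullback (isPullback_face vec mx R f).flip inferInstance

theorem face_id (σ : FanCone vec mx) : face vec mx R (𝟙 σ) = 𝟙 _ := by
  rw [← cancel_mono (incl vec mx R σ), Category.id_comp, face_incl]

theorem face_comp {υ τ σ : FanCone vec mx} (f : υ ⟶ τ) (g : τ ⟶ σ) :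
    face vec mx R (f ≫ g) = face vec mx R f ≫ face vec mx R g := by
  rw [← cancel_mono (incl vec mx R σ), Category.assoc, face_incl, face_incl, face_incl]

theorem exists_incl_eq (x : total vec mx R) : ∃ σ y, incl vec mx R σ y = x := by
  obtain ⟨σ, y, hy⟩ :=
    Scheme.IsLocallyDirected.ι_jointly_surjective (charts vec mx) (total.fst vec mx R x)
  obtain ⟨p, hp, -⟩ := Scheme.exists_preimage_of_isPullback
    (isPullback_incl vec mx R σ) x y hy.symm
  exact ⟨σ, p, hp⟩

/-- This is the directedness of the cover. Projected to ℙ_Σ, a point of the overlap already comes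
from a common face, and the cartesian square of the face inclusion lifts it back over S. -/
theorem exists_lift_face_eq {σ τ : FanCone vec mx}
    (x : ↥(pullback (incl vec mx R σ) (incl vec mx R τ))) :
    ∃ (υ : FanCone vec mx) (f : υ ⟶ σ) (g : υ ⟶ τ) (y : chartScheme vec mx R υ),
      pullback.lift (face vec mx R f) (face vec mx R g) (by rw [face_incl, face_incl]) y = x := by
  have h : (pullback.fst (incl vec mx R σ) (incl vec mx R τ) ≫ toChart vec mx R σ) ≫
      chartι vec mx σ =
      (pullback.snd (incl vec mx R σ) (incl vec mx R τ) ≫ toChart vec mx R τ) ≫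
        chartι vec mx τ := by
    rw [Category.assoc, Category.assoc, ← incl_fst, ← incl_fst, pullback.condition_assoc]
  have h2 := congr($h x)
  obtain ⟨υ, f, g, y, hy, -⟩ := (Scheme.IsLocallyDirected.ι_eq_ι_iff (charts vec mx)).mp h2
  obtain ⟨p, hp, -⟩ := Scheme.exists_preimage_of_isPullback (isPullback_face vec mx R f) _ y hy.symm
  -- The first projection of the overlap is an open immersion, so it is enough to compare images in
  -- the chart of σ.
  refine ⟨υ, f, g, p,
    (pullback.fst (incl vec mx R σ) (incl vec mx R τ)).isOpenEmbedding.injective ?_⟩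
  rw [← Scheme.Hom.comp_apply, pullback.lift_fst]
  exact hp

end chartScheme

instance : Finite (FanCone vec mx) := Subtype.finite

/-- The open cover of `ℙ_Σ × S` by the charts `U_σ × S`. -/
noncomputable def chartCover : (total vec mx R).OpenCover where
  I₀ := FanCone vec mx
  X := chartScheme vec mx R
  f := chartScheme.incl vec mx R
  mem₀ := by
    rw [Scheme.presieve₀_mem_precoverage_iff]
    exact ⟨chartScheme.exists_incl_eq vec mx R, fun σ => inferInstance⟩

instance : PartialOrder (chartCover vec mx R).I₀ := inferInstanceAs (PartialOrder (FanCone vec mx))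

instance : Finite (chartCover vec mx R).I₀ := inferInstanceAs (Finite (FanCone vec mx))

noncomputable instance : (chartCover vec mx R).LocallyDirected where
  trans f := chartScheme.face vec mx R f
  trans_id := chartScheme.face_id vec mx R
  trans_comp := chartScheme.face_comp vec mx R
  w f := chartScheme.face_incl vec mx R f
  directed := chartScheme.exists_lift_face_eq vec mx R
  property_trans f := chartScheme.isOpenImmersion_face vec mx R f

instance (i : (chartCover vec mx R).I₀) : IsAffine ((chartCover vec mx R).X i) :=
  chartScheme.isAffine vec mx R i

instance (i : (chartCover vec mx R).I₀) : QuasiCompact ((chartCover vec mx R).f i) :=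
  quasiCompact_of_locallyDirected _ i

end Cover

end Toric

namespace Toric

/-! ### The ideal of `V(s)` on the charts -/

section ZeroIdeal

variable {N : Type} [AddCommGroup N] {ι : Type} (vec : ι → N) (mx : Set (Set ι))
variable (R : Type) [CommRing R]

theorem chartToCox_single (σ : Set ι) (m : dualMonoid vec σ) (r : R) :
    chartToCox vec R σ (AddMonoidAlgebra.single m r) =
      AddMonoidAlgebra.single (fun ρ => m.1 (vec ρ)) r := by
  simp [chartToCox]

theorem chartToCox_faceMap {τ σ : Set ι} (h : IsFace vec τ σ) (x : ConeRing vec R σ) :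
    chartToCox vec R τ (faceMap vec R h x) = chartToCox vec R σ x := by
  induction x using AddMonoidAlgebra.induction_linear with
  | zero => simp
  | add x y hx hy => rw [map_add, map_add, map_add, hx, hy]
  | single m r =>
    simp only [faceMap, AddMonoidAlgebra.mapDomainRingHom_apply, AddMonoidAlgebra.mapDomain_single]
    rw [chartToCox_single, chartToCox_single]
    rfl

/-- Passing to a face τ inverts one monomial χ^m with m = 0 on τ and m > 0 on the other generators
of σ. A high power of χ^m clears denominators and makes the exponents on σ nonnegative without
changing them on τ; being a unit over τ, it can be removed again. -/
theorem map_faceMap_chartIdeal [Finite ι] {κ : Type} (s : κ → MvPolynomial ι R) {τ σ : Set ι}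
    (h : IsFace vec τ σ) :
    (chartIdeal vec R s σ).map (faceMap vec R h) = chartIdeal vec R s τ := by
  refine le_antisymm ?_ (Ideal.span_le.mpr ?_)
  · rw [chartIdeal, Ideal.map_span, Ideal.span_le]
    rintro _ ⟨g, ⟨i, b, hb, hg⟩, rfl⟩
    exact Ideal.subset_span ⟨i, b, fun ρ hρ => hb ρ (h.1 hρ), by rw [chartToCox_faceMap, hg]⟩
  · rintro g ⟨i, b, hb, hg⟩
    obtain ⟨m, hm0, hm⟩ := IsFace.exists_mem_dualMonoid vec h
    let _ := (faceMap vec R h).toAlgebra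
    have := faceMap_away vec R h m hm0 hm
    obtain ⟨n, g₁, hg₁⟩ := IsLocalization.Away.surj (AddMonoidAlgebra.single m (1 : R)) g
    change g * faceMap vec R h _ ^ n = faceMap vec R h g₁ at hg₁
    have hu : IsUnit (faceMap vec R h (AddMonoidAlgebra.single m 1)) :=
      IsLocalization.Away.algebraMap_isUnit (AddMonoidAlgebra.single m (1 : R))
    cases nonempty_fintype ι
    -- This k bounds every |b ρ|, so adding k·m makes the exponent nonnegative wherever m ≥ 1; the
    -- power n already clears the denominator of g.
    let k : ℕ := ∑ ρ, (b ρ).natAbs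
    have hk : ∀ ρ ∈ σ, 0 ≤ ((n + k : ℕ) • fun ρ => m.1 (vec ρ)) ρ + b ρ := by
      intro ρ hρ
      simp only [Pi.smul_apply, nsmul_eq_mul]
      by_cases hτ : ρ ∈ τ
      · rw [hm0 ρ hτ, mul_zero, zero_add]
        exact hb ρ hτ
      · have h1 : (b ρ).natAbs ≤ k := Finset.single_le_sum (f := fun ρ => (b ρ).natAbs)
          (fun _ _ => Nat.zero_le _) (Finset.mem_univ ρ)
        have h2 := hm ρ hρ hτ
        push_cast
        nlinarith [neg_abs_le (b ρ), Int.natCast_natAbs (b ρ)]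
    have hgen : chartToCox vec R σ (g₁ * AddMonoidAlgebra.single m 1 ^ k) =
        AddMonoidAlgebra.single (((n + k : ℕ) • fun ρ => m.1 (vec ρ)) + b) 1 *
          coxToLaurent R (s i) := by
      rw [← chartToCox_faceMap vec R h, map_mul, ← hg₁, map_pow, mul_assoc, ← pow_add, map_mul,
        hg, map_pow, chartToCox_faceMap, chartToCox_single, AddMonoidAlgebra.single_pow, one_pow,
        mul_comm, ← mul_assoc, AddMonoidAlgebra.single_mul_single, one_mul]
    have hmem : faceMap vec R h (g₁ * AddMonoidAlgebra.single m 1 ^ k) ∈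
        (chartIdeal vec R s σ).map (faceMap vec R h) :=
      Ideal.mem_map_of_mem _ (Ideal.subset_span ⟨i, _, hk, hgen⟩)
    rwa [map_mul, ← hg₁, map_pow, mul_assoc, ← pow_add,
      Ideal.mul_unit_mem_iff_mem _ (hu.pow _)] at hmem

variable [Finite ι]

/-- The ideal sheaf of `V(s) ∩ (U_σ × S)` on the chart `U_σ × S`. -/
noncomputable def chartIdealSheaf {κ : Type} (s : κ → MvPolynomial ι R) (σ : FanCone vec mx) :
    (chartScheme vec mx R σ).IdealSheafData :=
  Scheme.Hom.ker (Y := chartScheme vec mx R σ)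
    (Spec.map (CommRingCat.ofHom (Ideal.Quotient.mk (chartIdeal vec R s σ.1))))

theorem chartIdealSheaf_comap_face {κ : Type} (s : κ → MvPolynomial ι R) {τ σ : FanCone vec mx}
    (f : τ ⟶ σ) :
    (chartIdealSheaf vec mx R s σ).comap (chartScheme.face vec mx R f) =
      chartIdealSheaf vec mx R s τ := by
  refine (comap_ker_specMap_quotient (faceMap vec R f.le) _).trans ?_
  rw [map_faceMap_chartIdeal]
  rfl

variable [Algebra ℂ R]

theorem zeroIdeal_eq_iInf {κ : Type} (s : κ → MvPolynomial ι R) :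
    zeroIdeal vec mx R s =
      ⨅ σ, (chartIdealSheaf vec mx R s σ).map (chartScheme.incl vec mx R σ) :=
  iInf_congr fun σ => (Scheme.IdealSheafData.map_ker (Y := chartScheme vec mx R σ)
    (Spec.map (CommRingCat.ofHom (Ideal.Quotient.mk (chartIdeal vec R s σ.1))))
    (chartScheme.incl vec mx R σ)).symm

/-- The conditions imposed by the other charts cost nothing on the chart of σ, since the chart
ideals agree along faces. -/
theorem zeroIdeal_comap_incl {κ : Type} (s : κ → MvPolynomial ι R) (σ : FanCone vec mx) :
    (zeroIdeal vec mx R s).comap (chartScheme.incl vec mx R σ) =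
      chartIdealSheaf vec mx R s σ := by
  rw [zeroIdeal_eq_iInf]
  let J : ∀ i, ((chartCover vec mx R).X i).IdealSheafData := chartIdealSheaf vec mx R s
  have hJ : ∀ {i j : (chartCover vec mx R).I₀} (f : i ⟶ j),
      (J j).comap ((chartCover vec mx R).trans f) = J i := fun f =>
    chartIdealSheaf_comap_face vec mx R s f
  have h := comap_iInf_map (chartCover vec mx R) J hJ σ
  exact h

end ZeroIdeal

/-! ### Translations by points of the torus -/

section Translation

section Twist

variable (R : Type) [CommRing R] {S S' : Type} [AddMonoid S] [AddMonoid S']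

/-- The endomorphism `χ^m ↦ c(m) χ^m` of a monoid algebra. -/
noncomputable def twist (c : Multiplicative S →* Rˣ) :
    AddMonoidAlgebra R S →ₐ[R] AddMonoidAlgebra R S :=
  AddMonoidAlgebra.lift R (AddMonoidAlgebra R S) S
    { toFun := fun m => AddMonoidAlgebra.single m.toAdd (c m : R)
      map_one' := by simp [AddMonoidAlgebra.one_def]
      map_mul' := fun m m' => by simp [AddMonoidAlgebra.single_mul_single] }

theorem twist_single (c : Multiplicative S →* Rˣ) (m : S) (r : R) :
    twist R c (AddMonoidAlgebra.single m r) =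
      AddMonoidAlgebra.single m (r * c (.ofAdd m)) := by
  simp [twist, AddMonoidAlgebra.lift_single, AddMonoidAlgebra.smul_single]

theorem twist_twist (c c' : Multiplicative S →* Rˣ) (x : AddMonoidAlgebra R S) :
    twist R c (twist R c' x) = twist R (c * c') x := by
  induction x using AddMonoidAlgebra.induction_linear with
  | zero => simp
  | add x y hx hy => simp only [map_add, hx, hy]
  | single m r =>
    simp only [twist_single, MonoidHom.mul_apply, Units.val_mul]
    ring_nf

theorem twist_one (x : AddMonoidAlgebra R S) : twist R 1 x = x := by
  induction x using AddMonoidAlgebra.induction_linear with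
  | zero => simp
  | add x y hx hy => simp only [map_add, hx, hy]
  | single m r => simp [twist_single]

theorem mapDomain_twist (f : S →+ S') (c : Multiplicative S' →* Rˣ) (x : AddMonoidAlgebra R S) :
    AddMonoidAlgebra.mapDomainRingHom R f (twist R (c.comp f.toMultiplicative) x) =
      twist R c (AddMonoidAlgebra.mapDomainRingHom R f x) := by
  induction x using AddMonoidAlgebra.induction_linear with
  | zero => simp
  | add x y hx hy => simp only [map_add, hx, hy]
  | single m r => simp [twist_single]

end Twist

variable {N : Type} [AddCommGroup N] {ι : Type} (vec : ι → N) (mx : Set (Set ι))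
variable (R : Type) [CommRing R]

/-- The restriction of the translation by `c` to the coordinate ring of the chart of `σ`. -/
noncomputable def coneTwist (c : Multiplicative (Module.Dual ℤ N) →* Rˣ) (σ : Set ι) :
    ConeRing vec R σ →ₐ[R] ConeRing vec R σ :=
  twist R (c.comp (dualMonoid vec σ).subtype.toMultiplicative)

theorem coneTwist_comp_faceMap (c : Multiplicative (Module.Dual ℤ N) →* Rˣ) {τ σ : Set ι}
    (h : IsFace vec τ σ) :
    (coneTwist vec R c τ).toRingHom.comp (faceMap vec R h) =
      (faceMap vec R h).comp (coneTwist vec R c σ).toRingHom := by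
  exact RingHom.ext fun x => (mapDomain_twist R (AddSubmonoid.inclusion (h.dualMonoid_le vec))
    (c.comp (dualMonoid vec τ).subtype.toMultiplicative) x).symm

/-- The translation by `c` on the chart `U_σ × S`. -/
noncomputable def chartTranslation (c : Multiplicative (Module.Dual ℤ N) →* Rˣ)
    (σ : FanCone vec mx) : chartScheme vec mx R σ ⟶ chartScheme vec mx R σ :=
  Spec.map (CommRingCat.ofHom (coneTwist vec R c σ.1).toRingHom)

theorem chartTranslation_toBase (c : Multiplicative (Module.Dual ℤ N) →* Rˣ)
    (σ : FanCone vec mx) :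
    chartTranslation vec mx R c σ ≫ chartScheme.toBase vec mx R σ =
      chartScheme.toBase vec mx R σ := by
  change Spec.map _ ≫ Spec.map _ = Spec.map _
  rw [← Spec.map_comp, ← CommRingCat.ofHom_comp]
  congr 2
  ext r : 1
  exact (coneTwist vec R c σ.1).commutes r

theorem chartTranslation_comp (c c' : Multiplicative (Module.Dual ℤ N) →* Rˣ)
    (σ : FanCone vec mx) :
    chartTranslation vec mx R c σ ≫ chartTranslation vec mx R c' σ =
      chartTranslation vec mx R (c * c') σ := by
  change Spec.map _ ≫ Spec.map _ = Spec.map _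
  rw [← Spec.map_comp, ← CommRingCat.ofHom_comp]
  congr 2
  exact RingHom.ext fun x => twist_twist R _ _ x

theorem chartTranslation_one (σ : FanCone vec mx) : chartTranslation vec mx R 1 σ = 𝟙 _ := by
  have h : (coneTwist vec R 1 σ.1).toRingHom = RingHom.id _ :=
    RingHom.ext fun x => twist_one R x
  change Spec.map _ = 𝟙 (Spec _)
  rw [h, ← Spec.map_id]
  rfl

variable {mx}

/-- The cone `{0}`. -/
def zeroCone (h : ∃ σ ∈ mx, IsFace vec ∅ σ) : FanCone vec mx := ⟨∅, h⟩

/-- The inclusion of the torus `𝕋_N × S` as the chart of the cone `{0}`. -/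
noncomputable def torusToChart (h : ∃ σ ∈ mx, IsFace vec ∅ σ) :
    Spec (.of (AddMonoidAlgebra R (Module.Dual ℤ N))) ⟶ chartScheme vec mx R (zeroCone vec h) :=
  Spec.map (CommRingCat.ofHom (AddMonoidAlgebra.mapDomainRingHom R (dualMonoid vec ∅).subtype))

theorem torusToChart_chartTranslation (h : ∃ σ ∈ mx, IsFace vec ∅ σ)
    (c : Multiplicative (Module.Dual ℤ N) →* Rˣ) :
    torusToChart vec R h ≫ chartTranslation vec mx R c (zeroCone vec h) =
      translation R c ≫ torusToChart vec R h := by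
  change Spec.map _ ≫ Spec.map _ = Spec.map _ ≫ Spec.map _
  rw [← Spec.map_comp, ← Spec.map_comp, ← CommRingCat.ofHom_comp, ← CommRingCat.ofHom_comp]
  congr 2
  exact RingHom.ext fun x => mapDomain_twist R (dualMonoid vec ∅).subtype c x

variable (mx) {R}

/-- The map `U_σ × Spec R → U_σ × Spec R'` for `Spec R → Spec R'`. -/
noncomputable def chartMap {R' : Type} [CommRing R'] (φ : R' →+* R) (σ : FanCone vec mx) :
    chartScheme vec mx R σ ⟶ chartScheme vec mx R' σ :=
  Spec.map (CommRingCat.ofHom (AddMonoidAlgebra.mapRingHom (dualMonoid vec σ.1) φ))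

theorem chartMap_toBase {R' : Type} [CommRing R'] (φ : R' →+* R) (σ : FanCone vec mx) :
    chartMap vec mx φ σ ≫ chartScheme.toBase vec mx R' σ =
      chartScheme.toBase vec mx R σ ≫ Spec.map (CommRingCat.ofHom φ) := by
  change Spec.map _ ≫ Spec.map _ = Spec.map _ ≫ Spec.map _
  rw [← Spec.map_comp, ← Spec.map_comp, ← CommRingCat.ofHom_comp, ← CommRingCat.ofHom_comp]
  congr 2
  ext r : 1
  simp

variable (R) [Finite ι]

theorem face_chartTranslation (c : Multiplicative (Module.Dual ℤ N) →* Rˣ)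
    {τ σ : FanCone vec mx} (f : τ ⟶ σ) :
    chartScheme.face vec mx R f ≫ chartTranslation vec mx R c σ =
      chartTranslation vec mx R c τ ≫ chartScheme.face vec mx R f := by
  change Spec.map _ ≫ Spec.map _ = Spec.map _ ≫ Spec.map _
  rw [← Spec.map_comp, ← Spec.map_comp, ← CommRingCat.ofHom_comp, ← CommRingCat.ofHom_comp,
    coneTwist_comp_faceMap]

variable [Algebra ℂ R]

theorem face_chartTranslation_incl (c : Multiplicative (Module.Dual ℤ N) →* Rˣ)
    {τ σ : FanCone vec mx} (f : τ ⟶ σ) :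
    chartScheme.face vec mx R f ≫ chartTranslation vec mx R c σ ≫ chartScheme.incl vec mx R σ =
      chartTranslation vec mx R c τ ≫ chartScheme.incl vec mx R τ := by
  rw [← Category.assoc, face_chartTranslation, Category.assoc, chartScheme.face_incl]

/-- The translation by `c` on `ℙ_Σ × S`. -/
noncomputable def totalTranslation (c : Multiplicative (Module.Dual ℤ N) →* Rˣ) :
    total vec mx R ⟶ total vec mx R :=
  (chartCover vec mx R).glueMorphismsOfLocallyDirected
    (fun σ => chartTranslation vec mx R c σ ≫ chartScheme.incl vec mx R σ)
    fun f => face_chartTranslation_incl vec mx R c f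

theorem incl_totalTranslation (c : Multiplicative (Module.Dual ℤ N) →* Rˣ) (σ : FanCone vec mx) :
    chartScheme.incl vec mx R σ ≫ totalTranslation vec mx R c =
      chartTranslation vec mx R c σ ≫ chartScheme.incl vec mx R σ :=
  (chartCover vec mx R).map_glueMorphismsOfLocallyDirected _ _ σ

variable {vec mx R} in
theorem total_hom_ext_of_incl {Y : Scheme.{0}} {f g : total vec mx R ⟶ Y}
    (h : ∀ σ, chartScheme.incl vec mx R σ ≫ f = chartScheme.incl vec mx R σ ≫ g) : f = g :=
  (chartCover vec mx R).hom_ext f g h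

theorem totalTranslation_snd (c : Multiplicative (Module.Dual ℤ N) →* Rˣ) :
    totalTranslation vec mx R c ≫ total.snd vec mx R = total.snd vec mx R :=
  total_hom_ext_of_incl fun σ => by
    rw [← Category.assoc, incl_totalTranslation, Category.assoc, chartScheme.incl_snd,
      chartTranslation_toBase]

theorem totalTranslation_comp (c c' : Multiplicative (Module.Dual ℤ N) →* Rˣ) :
    totalTranslation vec mx R c ≫ totalTranslation vec mx R c' =
      totalTranslation vec mx R (c * c') :=
  total_hom_ext_of_incl fun σ => by
    rw [← Category.assoc, incl_totalTranslation, Category.assoc, incl_totalTranslation,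
      ← Category.assoc, chartTranslation_comp, incl_totalTranslation]

theorem totalTranslation_one : totalTranslation vec mx R 1 = 𝟙 _ :=
  total_hom_ext_of_incl fun σ => by
    rw [incl_totalTranslation, chartTranslation_one, Category.id_comp, Category.comp_id]

/-- The automorphism of `ℙ_Σ × S` over `S` given by the translation by `c`. -/
noncomputable def translationIso (c : Multiplicative (Module.Dual ℤ N) →* Rˣ) :
    total vec mx R ≅ total vec mx R where
  hom := totalTranslation vec mx R c
  inv := totalTranslation vec mx R c⁻¹
  hom_inv_id := by
    rw [totalTranslation_comp, ← totalTranslation_one]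
    exact congrArg _ (mul_inv_cancel c)
  inv_hom_id := by
    rw [totalTranslation_comp, ← totalTranslation_one]
    exact congrArg _ (inv_mul_cancel c)

variable {mx}

theorem torusToChart_incl (h : ∃ σ ∈ mx, IsFace vec ∅ σ) :
    torusToChart vec R h ≫ chartScheme.incl vec mx R (zeroCone vec h) = torusOver vec R h :=
  rfl

theorem torusOver_totalTranslation (h : ∃ σ ∈ mx, IsFace vec ∅ σ)
    (c : Multiplicative (Module.Dual ℤ N) →* Rˣ) :
    torusOver vec R h ≫ totalTranslation vec mx R c = translation R c ≫ torusOver vec R h := by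
  rw [← torusToChart_incl, Category.assoc, incl_totalTranslation, ← Category.assoc,
    torusToChart_chartTranslation, Category.assoc]

/-! ### Base change in S and the cartesian squares -/

variable (mx) {R}

theorem totalMap_fst {R' : Type} [CommRing R'] [Algebra ℂ R'] (φ : R' →ₐ[ℂ] R) :
    totalMap vec mx φ ≫ total.fst vec mx R' = total.fst vec mx R :=
  pullback.lift_fst _ _ _

theorem totalMap_snd {R' : Type} [CommRing R'] [Algebra ℂ R'] (φ : R' →ₐ[ℂ] R) :
    totalMap vec mx φ ≫ total.snd vec mx R' =
      total.snd vec mx R ≫ Spec.map (CommRingCat.ofHom φ.toRingHom) :=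
  pullback.lift_snd _ _ _

theorem chartMap_toChart {R' : Type} [CommRing R'] [Algebra ℂ R'] (φ : R' →ₐ[ℂ] R)
    (σ : FanCone vec mx) :
    chartMap vec mx φ.toRingHom σ ≫ chartScheme.toChart vec mx R' σ =
      chartScheme.toChart vec mx R σ := by
  change Spec.map _ ≫ Spec.map _ = Spec.map _
  rw [← Spec.map_comp, ← CommRingCat.ofHom_comp, ← AddMonoidAlgebra.mapRingHom_comp]
  have h : φ.toRingHom.comp (algebraMap ℂ R') = algebraMap ℂ R := φ.comp_algebraMap
  rw [h]

theorem incl_totalMap {R' : Type} [CommRing R'] [Algebra ℂ R'] (φ : R' →ₐ[ℂ] R)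
    (σ : FanCone vec mx) :
    chartScheme.incl vec mx R σ ≫ totalMap vec mx φ =
      chartMap vec mx φ.toRingHom σ ≫ chartScheme.incl vec mx R' σ := by
  refine total_hom_ext ?_ ?_
  · rw [Category.assoc, totalMap_fst, Category.assoc, chartScheme.incl_fst, chartScheme.incl_fst,
      ← Category.assoc, chartMap_toChart]
  · rw [Category.assoc, totalMap_snd, Category.assoc, chartScheme.incl_snd, chartMap_toBase,
      ← Category.assoc, chartScheme.incl_snd]

/-- Both products are base changes of ℙ_Σ over ℂ, so the left square is cartesian by cancellation.
-/
theorem isPullback_totalMap {R' : Type} [CommRing R'] [Algebra ℂ R'] (φ : R' →ₐ[ℂ] R) :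
    IsPullback (totalMap vec mx φ) (total.snd vec mx R) (total.snd vec mx R')
      (Spec.map (CommRingCat.ofHom φ.toRingHom)) := by
  refine IsPullback.of_right (h₁₂ := total.fst vec mx R')
    (h₂₂ := Spec.map (CommRingCat.ofHom (algebraMap ℂ R')))
    (v₁₃ := structureMap vec mx) ?_ (totalMap_snd vec mx φ) (IsPullback.of_hasPullback _ _)
  have h : φ.toRingHom.comp (algebraMap ℂ R') = algebraMap ℂ R := φ.comp_algebraMap
  rw [totalMap_fst, ← Spec.map_comp, ← CommRingCat.ofHom_comp, h]
  exact IsPullback.of_hasPullback _ _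

/-- If on every chart the ideal of `V(s)` is generated by the image of the ideal of `V(s')`, then
`V(s)` is up to translation the pullback of `V(s')`. -/
theorem isPullbackUpToTorus_of_map_chartIdeal (h : ∃ σ ∈ mx, IsFace vec ∅ σ) {κ : Type}
    {R' : Type} [CommRing R'] [Algebra ℂ R'] (φ : R' →ₐ[ℂ] R)
    (c : Multiplicative (Module.Dual ℤ N) →* Rˣ)
    (s : κ → MvPolynomial ι R) (s' : κ → MvPolynomial ι R')
    (hs : ∀ σ : Set ι, (chartIdeal vec R' s' σ).map ((coneTwist vec R c σ).toRingHom.comp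
      (AddMonoidAlgebra.mapRingHom (dualMonoid vec σ) φ.toRingHom)) = chartIdeal vec R s σ) :
    IsPullbackUpToTorus vec h φ c s s' := by
  let Φ := translationIso vec mx R c
  -- Everything reduces to this equality of ideal sheaves, which is checked on charts, where both
  -- maps are given by ring homomorphisms.
  have hcomap : (zeroIdeal vec mx R' s').comap (Φ.hom ≫ totalMap vec mx φ) =
      zeroIdeal vec mx R s := by
    refine idealSheaf_ext_of_openCover (chartCover vec mx R) fun (σ : FanCone vec mx) => ?_
    change Scheme.IdealSheafData.comap _ (chartScheme.incl vec mx R σ) =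
      Scheme.IdealSheafData.comap _ (chartScheme.incl vec mx R σ)
    have e : chartScheme.incl vec mx R σ ≫ Φ.hom ≫ totalMap vec mx φ =
        (chartTranslation vec mx R c σ ≫ chartMap vec mx φ.toRingHom σ) ≫
          chartScheme.incl vec mx R' σ := by
      change _ ≫ totalTranslation vec mx R c ≫ _ = _
      rw [← Category.assoc, incl_totalTranslation, Category.assoc, incl_totalMap, Category.assoc]
    rw [← Scheme.IdealSheafData.comap_comp, e, Scheme.IdealSheafData.comap_comp,
      zeroIdeal_comap_incl, zeroIdeal_comap_incl]
    have e' : chartTranslation vec mx R c σ ≫ chartMap vec mx φ.toRingHom σ =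
        Spec.map (CommRingCat.ofHom ((coneTwist vec R c σ.1).toRingHom.comp
          (AddMonoidAlgebra.mapRingHom (dualMonoid vec σ.1) φ.toRingHom))) := by
      rw [CommRingCat.ofHom_comp, Spec.map_comp]
      rfl
    rw [e']
    refine (comap_ker_specMap_quotient _ _).trans ?_
    rw [hs]
    rfl
  obtain ⟨g, hg⟩ := exists_isPullback_subschemeι (zeroIdeal vec mx R' s')
    (Φ.hom ≫ totalMap vec mx φ) (zeroIdeal vec mx R s).subschemeι
    (hcomap.trans (Scheme.IdealSheafData.ker_subschemeι _).symm)
  refine ⟨Φ, totalTranslation_snd vec mx R c, torusOver_totalTranslation vec R h c, g, hg, ?_⟩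
  -- An automorphism over S forms a cartesian square with the identity of S; pasting it with the
  -- base change square gives the pullback of families over the bases.
  have h1 : IsPullback Φ.hom (total.snd vec mx R) (total.snd vec mx R) (𝟙 _) :=
    IsPullback.of_horiz_isIso ⟨by
      rw [Category.comp_id]; exact totalTranslation_snd vec mx R c⟩
  have h2 := h1.paste_horiz (isPullback_totalMap vec mx φ)
  rw [Category.id_comp] at h2
  exact hg.paste_vert h2

/-- The intersection of `V(s)` with the torus. -/
theorem exists_isPullback_torusOver (h : ∃ σ ∈ mx, IsFace vec ∅ σ) {κ : Type}
    (s : κ → MvPolynomial ι R) (I : Ideal (AddMonoidAlgebra R (Module.Dual ℤ N)))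
    (hI : (chartIdeal vec R s ∅).map
      (AddMonoidAlgebra.mapDomainRingHom R (dualMonoid vec ∅).subtype) = I) :
    ∃ p : Spec (.of (AddMonoidAlgebra R (Module.Dual ℤ N) ⧸ I)) ⟶ zeroScheme vec mx R s,
      IsPullback p (Spec.map (CommRingCat.ofHom (Ideal.Quotient.mk I)))
        (zeroScheme.incl vec mx R s) (torusOver vec R h) := by
  have : IsClosedImmersion (Spec.map (CommRingCat.ofHom (Ideal.Quotient.mk I))) :=
    IsClosedImmersion.spec_of_surjective _ Ideal.Quotient.mk_surjective
  refine exists_isPullback_subschemeι (zeroIdeal vec mx R s) _ _ ?_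
  rw [← torusToChart_incl, Scheme.IdealSheafData.comap_comp, zeroIdeal_comap_incl, ← hI]
  exact comap_ker_specMap_quotient _ _

end Translation

end Toric

namespace Toric

/-! ### Ideals on the charts in terms of Laurent polynomials on the torus -/

section LaurentForm

variable {N : Type} [AddCommGroup N] {ι : Type} (vec : ι → N)
variable (R : Type) [CommRing R]

/-- The restriction `R[σ^∨ ∩ M] → R[M]` to the torus. -/
noncomputable def torusRestrict (σ : Set ι) :
    ConeRing vec R σ →+* AddMonoidAlgebra R (Module.Dual ℤ N) :=
  AddMonoidAlgebra.mapDomainRingHom R (dualMonoid vec σ).subtype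

theorem torusRestrict_single (σ : Set ι) (m : dualMonoid vec σ) (r : R) :
    torusRestrict vec R σ (AddMonoidAlgebra.single m r) = AddMonoidAlgebra.single m.1 r := by
  simp [torusRestrict]

theorem single_mem_range_torusRestrict {σ : Set ι} {m : Module.Dual ℤ N}
    (hm : m ∈ dualMonoid vec σ) (r : R) :
    AddMonoidAlgebra.single m r ∈ (torusRestrict vec R σ).range :=
  ⟨AddMonoidAlgebra.single ⟨m, hm⟩ r, torusRestrict_single vec R σ _ r⟩

theorem torusRestrict_injective (σ : Set ι) : Function.Injective (torusRestrict vec R σ) :=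
  AddMonoidAlgebra.mapDomain_injective Subtype.val_injective

/-- The pairing of `M` with the ray generators. -/
def rayPairing : Module.Dual ℤ N →+ (ι → ℤ) where
  toFun m ρ := m (vec ρ)
  map_zero' := rfl
  map_add' _ _ := rfl

/-- The map `χ^m ↦ ∏_ρ x_ρ^{⟨m, ρ⟩}` from the coordinate ring of the torus to the localized Cox
ring. -/
noncomputable def torusToCox :
    AddMonoidAlgebra R (Module.Dual ℤ N) →+* AddMonoidAlgebra R (ι → ℤ) :=
  AddMonoidAlgebra.mapDomainRingHom R (rayPairing vec)

theorem torusToCox_single (m : Module.Dual ℤ N) (r : R) :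
    torusToCox vec R (AddMonoidAlgebra.single m r) =
      AddMonoidAlgebra.single (rayPairing vec m) r := by
  simp [torusToCox]

theorem torusToCox_torusRestrict (σ : Set ι) (x : ConeRing vec R σ) :
    torusToCox vec R (torusRestrict vec R σ x) = chartToCox vec R σ x := by
  induction x using AddMonoidAlgebra.induction_linear with
  | zero => simp
  | add x y hx hy => simp only [map_add, hx, hy]
  | single m r =>
    rw [torusRestrict_single, torusToCox_single, chartToCox_single]
    rfl

theorem torusToCox_injective (h : Function.Injective (rayPairing vec)) :
    Function.Injective (torusToCox vec R) :=
  AddMonoidAlgebra.mapDomain_injective h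

variable {R}

/-- The element `s i` of the Cox ring is `x^{d i}` times the Laurent polynomial `F i` on the
torus, which has an invertible constant term; `d i` is large enough for `s i` to be a polynomial. -/
structure IsLaurentForm {κ : Type} (s : κ → MvPolynomial ι R) (d : κ → ι → ℤ)
    (F : κ → AddMonoidAlgebra R (Module.Dual ℤ N)) : Prop where
  coxToLaurent_eq (i : κ) :
    coxToLaurent R (s i) = AddMonoidAlgebra.single (d i) 1 * torusToCox vec R (F i)
  isUnit_coeff_zero (i : κ) : IsUnit ((F i).coeff 0)
  mem_range (i : κ) (σ : Set ι) (m : Module.Dual ℤ N) (hm : ∀ ρ ∈ σ, d i ρ ≤ m (vec ρ)) :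
    AddMonoidAlgebra.single m 1 * F i ∈ (torusRestrict vec R σ).range

variable {vec} {κ : Type} {s : κ → MvPolynomial ι R} {d : κ → ι → ℤ}
  {F : κ → AddMonoidAlgebra R (Module.Dual ℤ N)}

/-- If x^b s_i = x^(b + d_i) F_i comes from the chart ring, all its exponents lie in the image of M.
The exponent b + d_i occurs, with the invertible constant term of F_i as coefficient, so it is the
image of some m; injectivity of the pairing excludes cancellation. The condition b ≥ 0 on σ becomes
m ≥ d_i. -/
theorem IsLaurentForm.chartIdeal_eq (h : IsLaurentForm vec s d F)
    (hvec : Function.Injective (rayPairing vec)) (σ : Set ι) :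
    chartIdeal vec R s σ = Ideal.span {g | ∃ (i : κ) (m : Module.Dual ℤ N),
      (∀ ρ ∈ σ, d i ρ ≤ m (vec ρ)) ∧
        torusRestrict vec R σ g = AddMonoidAlgebra.single m 1 * F i} := by
  rw [chartIdeal]
  -- Over the zero ring a unit may vanish, and the support argument would fail.
  nontriviality R
  congr 1
  ext g
  constructor
  · rintro ⟨i, b, hb, hg⟩
    rw [h.coxToLaurent_eq, ← mul_assoc, AddMonoidAlgebra.single_mul_single, one_mul,
      ← torusToCox_torusRestrict] at hg
    have hcoeff : (torusToCox vec R (torusRestrict vec R σ g)).coeff (b + d i) ≠ 0 := by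
      have h1 : (torusToCox vec R (F i)).coeff 0 = (F i).coeff 0 := by
        rw [← map_zero (rayPairing vec)]
        exact Finsupp.mapDomain_apply hvec _ _
      rw [hg, AddMonoidAlgebra.coeff_single_mul_eq_mul_coeff 0 (by simp), one_mul, h1]
      exact (h.isUnit_coeff_zero i).ne_zero
    obtain ⟨m, hm⟩ : b + d i ∈ Set.range (rayPairing vec) := by
      by_contra hc
      exact hcoeff (Finsupp.mapDomain_of_notMem_range _ _ hc)
    refine ⟨i, m, fun ρ hρ => ?_, torusToCox_injective vec R hvec ?_⟩
    · have h1 : m (vec ρ) = b ρ + d i ρ := congr($hm ρ)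
      have h2 := hb ρ hρ
      omega
    · rw [hg, map_mul, torusToCox_single, hm]
  · rintro ⟨i, m, hm, hg⟩
    refine ⟨i, rayPairing vec m - d i, fun ρ hρ => sub_nonneg.mpr (hm ρ hρ), ?_⟩
    rw [h.coxToLaurent_eq, ← mul_assoc, AddMonoidAlgebra.single_mul_single, one_mul,
      sub_add_cancel, ← torusToCox_torusRestrict, hg, map_mul, torusToCox_single]

/-- For the cone {0} there is no condition on m: m = 0 gives F_i itself, and every other generator
is a monomial multiple of it. -/
theorem IsLaurentForm.map_torusRestrict_chartIdeal (h : IsLaurentForm vec s d F)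
    (hvec : Function.Injective (rayPairing vec)) :
    (chartIdeal vec R s ∅).map (torusRestrict vec R ∅) = Ideal.span (Set.range F) := by
  rw [h.chartIdeal_eq hvec, Ideal.map_span]
  refine le_antisymm (Ideal.span_le.mpr ?_) (Ideal.span_le.mpr ?_)
  · rintro _ ⟨g, ⟨i, m, -, hg⟩, rfl⟩
    rw [hg]
    exact Ideal.mul_mem_left _ _ (Ideal.subset_span ⟨i, rfl⟩)
  · rintro _ ⟨i, rfl⟩
    have h0 : ∀ ρ ∈ (∅ : Set ι), d i ρ ≤ (0 : Module.Dual ℤ N) (vec ρ) := by simp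
    obtain ⟨g, hg⟩ := h.mem_range i ∅ 0 h0
    refine Ideal.subset_span ⟨g, ⟨i, 0, h0, hg⟩, ?_⟩
    rw [hg, ← AddMonoidAlgebra.one_def, one_mul]

theorem torusRestrict_coneTwist_mapRingHom {R' : Type} [CommRing R'] (φ : R' →+* R)
    (c : Multiplicative (Module.Dual ℤ N) →* Rˣ) (σ : Set ι) (x : ConeRing vec R' σ) :
    torusRestrict vec R σ (coneTwist vec R c σ (AddMonoidAlgebra.mapRingHom _ φ x)) =
      twist R c (AddMonoidAlgebra.mapRingHom _ φ (torusRestrict vec R' σ x)) := by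
  refine (mapDomain_twist R (dualMonoid vec σ).subtype c _).trans ?_
  congr 1
  exact congr($(AddMonoidAlgebra.mapRingHom_comp_mapDomainRingHom φ
    (dualMonoid vec σ).subtype) x).symm

/-- The generator χ^m F'_i is sent to w_i⁻¹ c(m) χ^m F_i. Both families use the same exponents d, so
the same pairs (i, m) index the generators on both sides. -/
theorem IsLaurentForm.map_chartIdeal (h : IsLaurentForm vec s d F)
    (hvec : Function.Injective (rayPairing vec)) {R' : Type} [CommRing R']
    {s' : κ → MvPolynomial ι R'} {F' : κ → AddMonoidAlgebra R' (Module.Dual ℤ N)}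
    (h' : IsLaurentForm vec s' d F') (φ : R' →+* R)
    (c : Multiplicative (Module.Dual ℤ N) →* Rˣ) (w : κ → Rˣ)
    (hw : ∀ i, (w i : R) • twist R c (AddMonoidAlgebra.mapRingHom _ φ (F' i)) = F i) (σ : Set ι) :
    (chartIdeal vec R' s' σ).map ((coneTwist vec R c σ).toRingHom.comp
      (AddMonoidAlgebra.mapRingHom (dualMonoid vec σ) φ)) = chartIdeal vec R s σ := by
  have key : ∀ (i : κ) (m : Module.Dual ℤ N) (g : ConeRing vec R' σ),
      torusRestrict vec R' σ g = AddMonoidAlgebra.single m 1 * F' i →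
      (w i : R) • torusRestrict vec R σ (coneTwist vec R c σ (AddMonoidAlgebra.mapRingHom _ φ g)) =
        (c (.ofAdd m) : R) • (AddMonoidAlgebra.single m 1 * F i) := by
    intro i m g hg
    rw [torusRestrict_coneTwist_mapRingHom, hg, map_mul, map_mul, ← mul_smul_comm, hw,
      AddMonoidAlgebra.mapRingHom_single, twist_single, map_one, one_mul, ← smul_mul_assoc,
      AddMonoidAlgebra.smul_single, smul_eq_mul, mul_one]
  have hsmul : ∀ (r : R) (x : ConeRing vec R σ),
      torusRestrict vec R σ (r • x) = r • torusRestrict vec R σ x := fun r x =>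
    map_smul (AddMonoidAlgebra.mapDomainAlgHom R R (dualMonoid vec σ).subtype) r x
  rw [h.chartIdeal_eq hvec, h'.chartIdeal_eq hvec, Ideal.map_span]
  refine le_antisymm (Ideal.span_le.mpr ?_) (Ideal.span_le.mpr ?_)
  · rintro _ ⟨g, ⟨i, m, hm, hg⟩, rfl⟩
    change coneTwist vec R c σ (AddMonoidAlgebra.mapRingHom _ φ g) ∈ _
    rw [← inv_smul_smul ((c (.ofAdd m))⁻¹ * w i)
      (coneTwist vec R c σ (AddMonoidAlgebra.mapRingHom _ φ g))]
    refine Submodule.smul_of_tower_mem _ _ (Ideal.subset_span ⟨i, m, hm, ?_⟩)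
    rw [mul_smul, Units.smul_def, Units.smul_def, hsmul, hsmul, key i m g hg, smul_smul,
      Units.inv_mul, one_smul]
  · rintro g ⟨i, m, hm, hg⟩
    -- The converse needs χ^m F'_i to be regular on the chart over R', which the bound m ≥ d_i
    -- guarantees.
    obtain ⟨g', hg'⟩ := h'.mem_range i σ m hm
    have e : g = ((c (.ofAdd m))⁻¹ * w i) •
        coneTwist vec R c σ (AddMonoidAlgebra.mapRingHom _ φ g') := by
      refine torusRestrict_injective vec R σ ?_
      rw [mul_smul, Units.smul_def, Units.smul_def, hsmul, hsmul, key i m g' hg', smul_smul,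
        Units.inv_mul, one_smul, hg]
    rw [e]
    exact Submodule.smul_of_tower_mem _ _ (Ideal.subset_span ⟨g', ⟨i, m, hm, hg'⟩, rfl⟩)

end LaurentForm

end Toric

namespace BB

/-! ### The sections as Laurent polynomials -/

open Toric

/-- The exponent vectors of `∏ u_{i₁i₂i₃}` and `∏ v_{i₁i₂i₃}`. -/
def divisorExponent : Fin 2 → Ray → ℤ :=
  ![Sum.elim 1 0, Sum.elim 0 1]

theorem t_vec (k : Fin 6) (ρ : Ray) :
    t k (vec ρ) = mult k ρ - ∑ l, if ρ.origin l = k then 1 else 0 := by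
  simp [t, vec, mult, Finset.sum_apply, Pi.single_apply, eq_comm]

/-- The divisor of x^(k) is D₁ plus the divisor of t_k: the base point of each u contains e_k
exactly once, and that of each v not at all. For k ≥ 4 in the numbering from 1, the roles of u and v
are exchanged. -/
theorem mult_eq_of_lt {k : Fin 6} (hk : k < 3) (ρ : Ray) :
    (mult k ρ : ℤ) = divisorExponent 0 ρ + t k (vec ρ) := by
  rw [t_vec]
  have : k = 0 ∨ k = 1 ∨ k = 2 := by revert k; decide
  rcases ρ with ρ | ρ <;> rcases this with rfl | rfl | rfl <;>
    simp [divisorExponent, Ray.origin, Fin.sum_univ_three]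

theorem mult_eq_of_le {k : Fin 6} (hk : 3 ≤ k) (ρ : Ray) :
    (mult k ρ : ℤ) = divisorExponent 1 ρ + t k (vec ρ) := by
  rw [t_vec]
  have : k = 3 ∨ k = 4 ∨ k = 5 := by revert k; decide
  rcases ρ with ρ | ρ <;> rcases this with rfl | rfl | rfl <;>
    simp [divisorExponent, Ray.origin, Fin.sum_univ_three]

variable (R : Type) [CommRing R]

/-- The Laurent polynomials `b - a_1 t_1 - a_2 t_2 - a_3 t_3` and
`b' - a_4 t_4 - a_5 t_5 - a_6 t_6`. -/
noncomputable def laurentSections (b b' : R) (a : Fin 6 → R) : Fin 2 → AddMonoidAlgebra R M :=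
  ![.single 0 b - ∑ k : Fin 6 with k < 3, .single (t k) (a k),
    .single 0 b' - ∑ k : Fin 6 with 3 ≤ k, .single (t k) (a k)]

theorem coxToLaurent_X (ρ : Ray) :
    coxToLaurent R (MvPolynomial.X ρ) =
      AddMonoidAlgebra.single (fun ρ' => if ρ' = ρ then (1 : ℤ) else 0) 1 := by
  rw [coxToLaurent, MvPolynomial.aeval_X]
  congr 1
  ext ρ'
  simp [Pi.single_apply]

theorem coxToLaurent_prod_X_pow (e : Ray → ℕ) :
    coxToLaurent R (∏ ρ, MvPolynomial.X ρ ^ e ρ) =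
      AddMonoidAlgebra.single (fun ρ => (e ρ : ℤ)) 1 := by
  have h : ∀ s : Finset Ray, coxToLaurent R (∏ ρ ∈ s, MvPolynomial.X ρ ^ e ρ) =
      AddMonoidAlgebra.single (fun ρ => if ρ ∈ s then (e ρ : ℤ) else 0) 1 := by
    intro s
    induction s using Finset.induction_on with
    | empty =>
      simp only [Finset.prod_empty, map_one, Finset.notMem_empty, if_false]
      rfl
    | insert ρ s hρ ih =>
      rw [Finset.prod_insert hρ, map_mul, ih, map_pow, coxToLaurent_X,
        AddMonoidAlgebra.single_pow, AddMonoidAlgebra.single_mul_single, one_pow, one_mul]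
      congr 1
      ext ρ'
      by_cases h : ρ' = ρ
      · subst h
        simp [hρ]
      · simp [h]
  simpa using h Finset.univ

theorem coxToLaurent_prod_inl :
    coxToLaurent R (∏ i, MvPolynomial.X (.inl i)) =
      AddMonoidAlgebra.single (divisorExponent 0) 1 := by
  have h := coxToLaurent_prod_X_pow R (Sum.elim 1 0)
  simp only [Fintype.prod_sum_type, Sum.elim_inl, Sum.elim_inr, Pi.one_apply, Pi.zero_apply,
    pow_one, pow_zero, Finset.prod_const_one, mul_one] at h
  rw [h]
  congr 1
  ext (ρ | ρ) <;> rfl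

theorem coxToLaurent_prod_inr :
    coxToLaurent R (∏ i, MvPolynomial.X (.inr i)) =
      AddMonoidAlgebra.single (divisorExponent 1) 1 := by
  have h := coxToLaurent_prod_X_pow R (Sum.elim 0 1)
  simp only [Fintype.prod_sum_type, Sum.elim_inl, Sum.elim_inr, Pi.one_apply, Pi.zero_apply,
    pow_one, pow_zero, Finset.prod_const_one, one_mul] at h
  rw [h]
  congr 1
  ext (ρ | ρ) <;> rfl

theorem coxToLaurent_mono (k : Fin 6) :
    coxToLaurent R (mono R k) = AddMonoidAlgebra.single (fun ρ => (mult k ρ : ℤ)) 1 :=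
  coxToLaurent_prod_X_pow R _

/-- The vector `e_i - e_6`. -/
def diff (i : Fin 6) : N :=
  ⟨Pi.single i 1 - Pi.single 5 1, by simp [LinearMap.mem_ker]⟩

theorem t_diff (i j : Fin 6) :
    t i (diff j) = (if i = j then 1 else 0) - if i = 5 then 1 else 0 := by
  simp [t, diff, Pi.single_apply]

/-- Evaluation at e_i - e_6, or at e_1 - e_6 for the last index, is nonzero. Hence the terms a_k t_k
do not contribute to the constant term of a section. -/
theorem t_ne_zero (i : Fin 6) : t i ≠ 0 := by
  intro h
  have h1 := t_diff i i
  have h2 := t_diff i 0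
  rw [h] at h1 h2
  by_cases hi : i = 5
  · subst hi
    simp at h2
  · simp [hi] at h1

theorem sum_eq_zero (x : N) : ∑ i, x.1 i = 0 := by
  have h := LinearMap.mem_ker.mp x.2
  rwa [LinearMap.sum_apply] at h

/-- The rays u_{iii} suffice: 3(e_i - e_6) = u_{iii} - u_{666}, ℤ is torsion-free, and the vectors
e_i - e_6 generate N. -/
theorem eq_zero_of_vec {m : M} (hm : ∀ ρ, m (vec ρ) = 0) : m = 0 := by
  have hne : ∀ i : Fin 6, (fun _ : Fin 3 => i) ≠ ![0, 1, 2] := by decide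
  have hu : ∀ i : Fin 6, 3 • diff i = vec (.inl ⟨fun _ => i, monotone_const, hne i⟩) -
      vec (.inl ⟨fun _ => 5, monotone_const, hne 5⟩) := fun i => by
    ext j
    simp [diff, vec, Ray.triple, Ray.origin]
    ring
  have hd : ∀ i, m (diff i) = 0 := fun i => by
    have h1 := congr(m $(hu i))
    rw [map_nsmul, map_sub, hm, hm, sub_zero] at h1
    simpa using h1
  ext x
  have hx : x = ∑ i, x.1 i • diff i := by
    ext j
    have h0 := sum_eq_zero x
    simp [diff, Finset.sum_apply, Pi.single_apply, mul_sub, h0]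
  rw [hx]
  simp [hd]

theorem rayPairing_injective : Function.Injective (rayPairing vec) :=
  (injective_iff_map_eq_zero _).mpr fun _ hm => eq_zero_of_vec fun ρ => congr($hm ρ)

variable {R} in
theorem isUnit_coeff_zero_sub_sum {b : R} (hb : IsUnit b) (a : Fin 6 → R) (s : Finset (Fin 6)) :
    IsUnit ((.single 0 b - ∑ k ∈ s, .single (t k) (a k) : AddMonoidAlgebra R M).coeff 0) := by
  have h : ∀ k, Finsupp.single (t k) (a k) 0 = 0 :=
    fun k => Finsupp.single_eq_of_ne (t_ne_zero k).symm
  simpa [h] using hb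

variable {R} in
-- On σ one has m ≥ d ≥ 0, and m + t_k = (m - d) + mult_k ≥ 0, so every monomial of the product is
-- regular on the chart.
theorem single_mul_mem_range (b : R) (a : Fin 6 → R) (s : Finset (Fin 6)) (d : Ray → ℤ)
    (hd : ∀ ρ, 0 ≤ d ρ) (hs : ∀ k ∈ s, ∀ ρ, (mult k ρ : ℤ) = d ρ + t k (vec ρ)) (σ : Set Ray)
    (m : M) (hm : ∀ ρ ∈ σ, d ρ ≤ m (vec ρ)) :
    .single m 1 * (.single 0 b - ∑ k ∈ s, .single (t k) (a k) : AddMonoidAlgebra R M) ∈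
      (torusRestrict vec R σ).range := by
  rw [mul_sub, Finset.mul_sum]
  refine sub_mem ?_ (sum_mem fun k hk => ?_)
  · rw [AddMonoidAlgebra.single_mul_single, add_zero]
    exact single_mem_range_torusRestrict vec R (fun ρ hρ => (hd ρ).trans (hm ρ hρ)) _
  · rw [AddMonoidAlgebra.single_mul_single]
    refine single_mem_range_torusRestrict vec R (fun ρ hρ => ?_) _
    have h1 := hs k hk ρ
    have h2 := hm ρ hρ
    rw [LinearMap.add_apply]
    omega

variable {R} in
theorem coxToLaurent_C_mul_sub_sum (b : R) (a : Fin 6 → R) (s : Finset (Fin 6)) (d : Ray → ℤ)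
    (hs : ∀ k ∈ s, ∀ ρ, (mult k ρ : ℤ) = d ρ + t k (vec ρ)) (p : MvPolynomial Ray R)
    (hp : coxToLaurent R p = AddMonoidAlgebra.single d 1) :
    coxToLaurent R (MvPolynomial.C b * p - ∑ k ∈ s, MvPolynomial.C (a k) * mono R k) =
      AddMonoidAlgebra.single d 1 *
        torusToCox vec R (.single 0 b - ∑ k ∈ s, .single (t k) (a k)) := by
  have hC : ∀ r : R, coxToLaurent R (MvPolynomial.C r : MvPolynomial Ray R) =
      AddMonoidAlgebra.single 0 r := fun r => by
    rw [coxToLaurent, MvPolynomial.aeval_C]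
    rfl
  rw [map_sub, map_sub, mul_sub, map_sum, map_sum, Finset.mul_sum, map_mul, hC, hp,
    torusToCox_single, AddMonoidAlgebra.single_mul_single, AddMonoidAlgebra.single_mul_single,
    map_zero, zero_add, add_zero, mul_one, one_mul]
  congr 1
  refine Finset.sum_congr rfl fun k hk => ?_
  rw [map_mul, hC, coxToLaurent_mono, torusToCox_single, AddMonoidAlgebra.single_mul_single,
    AddMonoidAlgebra.single_mul_single, mul_one, one_mul, zero_add]
  congr 1
  ext ρ
  exact hs k hk ρ

theorem divisorExponent_nonneg (i : Fin 2) (ρ : Ray) : 0 ≤ divisorExponent i ρ := by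
  fin_cases i <;> rcases ρ with ρ | ρ <;> simp [divisorExponent]

variable {R} in
theorem isLaurentForm_sections {b b' : R} (hb : IsUnit b) (hb' : IsUnit b') (a : Fin 6 → R) :
    IsLaurentForm vec (sections R b b' a) divisorExponent (laurentSections R b b' a) where
  coxToLaurent_eq := Fin.forall_fin_two.mpr
    ⟨coxToLaurent_C_mul_sub_sum b a _ _
      (fun _ hk => mult_eq_of_lt (Finset.mem_filter.mp hk).2) _ (coxToLaurent_prod_inl R),
    coxToLaurent_C_mul_sub_sum b' a _ _
      (fun _ hk => mult_eq_of_le (Finset.mem_filter.mp hk).2) _ (coxToLaurent_prod_inr R)⟩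
  isUnit_coeff_zero := Fin.forall_fin_two.mpr
    ⟨isUnit_coeff_zero_sub_sum hb a _, isUnit_coeff_zero_sub_sum hb' a _⟩
  mem_range := Fin.forall_fin_two.mpr
    ⟨single_mul_mem_range b a _ _ (divisorExponent_nonneg 0)
      (fun _ hk => mult_eq_of_lt (Finset.mem_filter.mp hk).2),
    single_mul_mem_range b' a _ _ (divisorExponent_nonneg 1)
      (fun _ hk => mult_eq_of_le (Finset.mem_filter.mp hk).2)⟩

/-! ### Points of the torus -/

variable {R}

/-- The point of the torus with coordinates `t_i = w_i` for `i ≤ 5`. -/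
def torusPoint (w : Fin 5 → Rˣ) : Multiplicative M →* Rˣ where
  -- The characters t₁, …, t₅ are dual to the vectors e_i - e_6, so m(e_i - e_6) is the exponent of
  -- t_i in m.
  toFun m := ∏ i, w i ^ (m.toAdd (diff i.castSucc))
  map_one' := by simp
  map_mul' m m' := by simp [zpow_add, Finset.prod_mul_distrib]

theorem torusPoint_t (w : Fin 5 → Rˣ) (i : Fin 5) :
    torusPoint w (.ofAdd (t i.castSucc)) = w i := by
  change ∏ j, w j ^ (t i.castSucc (diff j.castSucc)) = w i
  have h5 : i.castSucc ≠ 5 := (Fin.castSucc_lt_last i).ne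
  rw [Finset.prod_eq_single i]
  · simp [t_diff, h5]
  · intro j _ hj
    simp [t_diff, h5, hj.symm]
  · simp

theorem torusPoint_t_last (w : Fin 5 → Rˣ) :
    torusPoint w (.ofAdd (t 5)) = (∏ i, w i)⁻¹ := by
  change ∏ j, w j ^ (t 5 (diff j.castSucc)) = (∏ i, w i)⁻¹
  rw [← Finset.prod_inv_distrib]
  refine Finset.prod_congr rfl fun j _ => ?_
  have h5 : 5 ≠ j.castSucc := (Fin.castSucc_lt_last j).ne'
  simp [t_diff, h5]

theorem t_five : t 5 = -(t 0 + t 1 + t 2 + t 3 + t 4) := by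
  ext x
  have h := sum_eq_zero x
  rw [Fin.sum_univ_six] at h
  simp only [t, LinearMap.comp_apply, LinearMap.proj_apply, LinearMap.neg_apply,
    LinearMap.add_apply, Submodule.subtype_apply]
  omega

theorem toGm_coord [Algebra ℂ R] (w : Rˣ) : toGm w (coord : Gm) = w := by
  change AddMonoidAlgebra.lift ℂ R ℤ _ (AddMonoidAlgebra.single 1 1) = _
  rw [AddMonoidAlgebra.lift_single]
  simp

/-! ### The change of coordinates between the families -/

/-- The twist is diagonal on monomials. After rescaling the constant term 1 to b or b', what remains
is one equation per coefficient. -/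
theorem twist_laurentSections {R' : Type} [CommRing R'] (φ : R' →+* R)
    (c : Multiplicative M →* Rˣ) (b b' : Rˣ) (a : Fin 6 → R) (a' : Fin 6 → R')
    (h : ∀ k < 3, a k = b * (φ (a' k) * c (.ofAdd (t k))))
    (h' : ∀ k, 3 ≤ k → a k = b' * (φ (a' k) * c (.ofAdd (t k)))) (i : Fin 2) :
    ((![b, b'] : Fin 2 → Rˣ) i : R) •
        twist R c (AddMonoidAlgebra.mapRingHom _ φ (laurentSections R' 1 1 a' i)) =
      laurentSections R b b' a i := by
  have key : ∀ (β : Rˣ) (s : Finset (Fin 6)),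
      (∀ k ∈ s, a k = β * (φ (a' k) * c (.ofAdd (t k)))) →
      (β : R) • twist R c (AddMonoidAlgebra.mapRingHom _ φ
        (.single 0 1 - ∑ k ∈ s, .single (t k) (a' k) : AddMonoidAlgebra R' M)) =
      .single 0 (β : R) - ∑ k ∈ s, .single (t k) (a k) := by
    intro β s hs
    rw [map_sub, map_sub, map_sum, map_sum, smul_sub, Finset.smul_sum]
    congr 1
    · simp [twist_single, AddMonoidAlgebra.smul_single]
    · refine Finset.sum_congr rfl fun k hk => ?_
      rw [AddMonoidAlgebra.mapRingHom_single, twist_single, AddMonoidAlgebra.smul_single,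
        hs k hk, smul_eq_mul]
  revert i
  exact Fin.forall_fin_two.mpr ⟨key b _ fun k hk => h k (Finset.mem_filter.mp hk).2,
    key b' _ fun k hk => h' k (Finset.mem_filter.mp hk).2⟩

/-- The first five coordinates of the translation are prescribed and the sixth is forced; z is the
value that makes the coefficient of t_6 come out right. -/
theorem isPullbackOfZ [Algebra ℂ R] (ξ₁ ξ₂ : Rˣ) (a : Fin 6 → Rˣ) : IsPullbackOfZ ξ₁ ξ₂ a := by
  let b := three R * ξ₁
  let b' := three R * ξ₂
  let w : Fin 5 → Rˣ := ![a 0 / b, a 1 / b, a 2 / b, a 3 / b', a 4 / b']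
  have hlt : ∀ i : Fin 6, i < 3 → torusPoint w (.ofAdd (t i)) = a i / b := by
    intro i hi
    have : i = 0 ∨ i = 1 ∨ i = 2 := by revert i; decide
    rcases this with rfl | rfl | rfl
    exacts [torusPoint_t w 0, torusPoint_t w 1, torusPoint_t w 2]
  have hle : ∀ i : Fin 6, i = 3 ∨ i = 4 → torusPoint w (.ofAdd (t i)) = a i / b' := by
    rintro i (rfl | rfl)
    exacts [torusPoint_t w 3, torusPoint_t w 4]
  let z : Rˣ := (∏ i, a i) / (b ^ 3 * b' ^ 3)
  have h5 : z * torusPoint w (.ofAdd (t 5)) = a 5 / b' := by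
    rw [torusPoint_t_last, Fin.prod_univ_five]
    simp only [z, w, Fin.prod_univ_six, Matrix.cons_val]
    simp only [div_eq_mul_inv, mul_inv, inv_inv, ← inv_pow]
    -- The intermediate product displays the cancellations: three factors of b, two of b', and a_1,
    -- …, a_5, leaving a_6/b'. The rearrangement is done in R, where `ring` applies.
    refine Eq.trans (b := a 0 * (a 0)⁻¹ * (a 1 * (a 1)⁻¹) * (a 2 * (a 2)⁻¹) * (a 3 * (a 3)⁻¹) *
      (a 4 * (a 4)⁻¹) * (b * b⁻¹) ^ 3 * (b' * b'⁻¹) ^ 2 * (a 5 * b'⁻¹)) (Units.ext ?_) (by simp)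
    push_cast
    ring
  have e3 : ∀ ξ : Rˣ, (3 * ξ : R) = ((three R * ξ : Rˣ) : R) := fun ξ => by
    simp [three, ← map_ofNat (algebraMap ℂ R) 3]
  refine ⟨torusPoint w, hlt, hle, isPullbackUpToTorus_of_map_chartIdeal vec maxCones zero_mem_fan
    _ _ _ _ ?_⟩
  rw [sectionsBB, e3, e3]
  refine (isLaurentForm_sections (Units.isUnit b) (Units.isUnit b') _).map_chartIdeal
    rayPairing_injective (isLaurentForm_sections isUnit_one isUnit_one _) _ _ ![b, b']
    (twist_laurentSections _ _ _ _ _ _ ?_ ?_)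
  · intro k hk
    have : k = 0 ∨ k = 1 ∨ k = 2 := by revert k; decide
    have ha : (![1, 1, 1, 1, 1, coord] : Fin 6 → Gm) k = 1 := by
      rcases this with rfl | rfl | rfl <;> rfl
    rw [ha, map_one, one_mul, hlt k hk, ← Units.val_mul, mul_div_cancel]
  · intro k hk
    have : (k = 3 ∨ k = 4) ∨ k = 5 := by revert k; decide
    rcases this with h | rfl
    · have ha : (![1, 1, 1, 1, 1, coord] : Fin 6 → Gm) k = 1 := by
        rcases h with rfl | rfl <;> rfl
      rw [ha, map_one, one_mul, hle k h, ← Units.val_mul, mul_div_cancel]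
    · have ha : (toGm z).toRingHom ((![1, 1, 1, 1, 1, coord] : Fin 6 → Gm) 5) = z :=
        toGm_coord z
      rw [ha, ← Units.val_mul, h5, ← Units.val_mul, mul_div_cancel]

end BB

theorem mainTheorem7 :
    (∃ p : Spec (.of (AddMonoidAlgebra BB.Gm BB.M ⧸ Ideal.span
          {(1 - .single (BB.t 0) 1 - .single (BB.t 1) 1 - .single (BB.t 2) 1 :
              AddMonoidAlgebra BB.Gm BB.M),
            1 - .single (BB.t 3) 1 - .single (BB.t 4) 1 -
              .single (-(BB.t 0 + BB.t 1 + BB.t 2 + BB.t 3 + BB.t 4)) (BB.coord : BB.Gm)})) ⟶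
        Toric.zeroScheme BB.vec BB.maxCones BB.Gm BB.sectionsZ,
      IsPullback p (Spec.map (CommRingCat.ofHom (Ideal.Quotient.mk _)))
        (Toric.zeroScheme.incl BB.vec BB.maxCones BB.Gm BB.sectionsZ)
        (Toric.torusOver BB.vec BB.Gm BB.zero_mem_fan)) ∧
    BB.IsPullbackOfZ 1 1 BB.a ∧
    (∀ (R : Type) [CommRing R] [Algebra ℂ R] (ξ₁ ξ₂ : Rˣ) (a : Fin 6 → Rˣ),
      BB.IsPullbackOfZ ξ₁ ξ₂ a) ∧
    ∃ c : Multiplicative BB.M →* BB.Gmˣ,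
      (∀ i : Fin 6, i < 5 → c (.ofAdd (BB.t i)) = 1 / (BB.three BB.Gm * BB.coord)) ∧
      Toric.IsPullbackUpToTorus BB.vec BB.zero_mem_fan
        (BB.toGm ((BB.three BB.Gm * BB.coord) ^ (-6 : ℤ))) c BB.sectionsPsi BB.sectionsZ := by
  refine ⟨?_, BB.isPullbackOfZ 1 1 BB.a, fun R _ _ => BB.isPullbackOfZ, ?_⟩
  · refine Toric.exists_isPullback_torusOver BB.vec BB.maxCones BB.zero_mem_fan BB.sectionsZ _ ?_
    refine ((BB.isLaurentForm_sections isUnit_one isUnit_one _).map_torusRestrict_chartIdeal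
      BB.rayPairing_injective).trans ?_
    have h1 : (Finset.univ.filter fun k : Fin 6 => k < 3) = {0, 1, 2} := by decide
    have h2 : (Finset.univ.filter fun k : Fin 6 => 3 ≤ k) = {3, 4, 5} := by decide
    congr 1
    rw [BB.laurentSections, h1, h2, Matrix.range_cons, Matrix.range_cons_empty,
      Set.singleton_union, ← BB.t_five]
    have h3 : ∀ (f : Fin 6 → AddMonoidAlgebra BB.Gm BB.M) (i j k : Fin 6), i ≠ j → i ≠ k → j ≠ k →
        ∀ x, x - ∑ l ∈ {i, j, k}, f l = x - f i - f j - f k := fun f i j k hij hik hjk x => by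
      rw [Finset.sum_insert (by simp [hij, hik]), Finset.sum_pair hjk, sub_sub, sub_sub]
    rw [h3 _ _ _ _ (by decide) (by decide) (by decide),
      h3 _ _ _ _ (by decide) (by decide) (by decide)]
    rfl
  -- The family 𝒴_ψ is the case ξ₁ = ξ₂ = ψ with all a_i = 1, so the two scalings coincide and z =
  -- (3ψ)⁻⁶.
  · obtain ⟨c, hlt, hle, hc⟩ := BB.isPullbackOfZ BB.coord BB.coord (1 : Fin 6 → BB.Gmˣ)
    refine ⟨c, fun i hi => ?_, ?_⟩
    · by_cases h : i < 3
      · exact hlt i h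
      · exact hle i (by revert i; decide)
    · have h : (∏ i, (1 : Fin 6 → BB.Gmˣ) i) / ((BB.three BB.Gm * BB.coord) ^ 3 *
          (BB.three BB.Gm * BB.coord) ^ 3) = (BB.three BB.Gm * BB.coord) ^ (-6 : ℤ) := by
        rw [← pow_add, zpow_neg]
        simp
      rw [h] at hc
      exact hc
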